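/- Let $K$ be a field and let $A$ be a (unital, associative) $K$-algebra which is $2$-Calabi-Yau, meaning: as an $A$-bimodule (with $K$ acting centrally) $A$ has a projective resolution of finite length by finitely generated bimodules, and $\mathrm{RHom}_{AA}(A,A\otimes_K A)\cong A[-2]$ in the derived category of $A$-bimodules, where $\mathrm{Hom}_{AA}$ is taken for the outer bimodule structure $b(a\otimes a')c=ba\otimes a'c$ on $A\otimes_K A$ and is itself a bimodule through the inner one, $(bfc)(m)=\sum a c\otimes b a'$ if $f(m)=\sum a\otimes a'$. Let $\mathcal S$ be a set of finite-dimensional simple left $A$-modules which are rigid, i.e. $\mathrm{Ext}^1_A(S,S)=0$ for all $S\in\mathcal S$, and suppose that $\mathcal S$ is split, i.e. $\mathrm{End}_A(S)=K$ for all $S\in\mathcal S$. For $S\in\mathcal S$ let $I_S=\{a\in A\mid aS=0\}$, and let $\mathcal I(\mathcal S)$ be the set of all ideals of the form $I_{S_1}I_{S_2}\cdots I_{S_r}$ with $r\ge 0$ and $S_1,\dots,S_r\in\mathcal S$ (the empty product being $A$). Let $W(\mathcal S)$ be the group with one generator $\sigma_S$ for each $S\in\mathcal S$ up to isomorphism (so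 $\sigma_S=\sigma_{T}$ if $S\cong T$), subject to the relations $\sigma_S^2=1$ for all $S$, $\sigma_S\sigma_T=\sigma_T\sigma_S$ if $\mathrm{Ext}^1_A(S,T)=0$, and $\sigma_S\sigma_T\sigma_S=\sigma_T\sigma_S\sigma_T$ if $\dim_K\mathrm{Ext}^1_A(S,T)=1$ (the Coxeter group of the Ext-quiver of $\mathcal S$, which has $\dim_K\mathrm{Ext}^1_A(S,T)$ arrows from $S$ to $T$). Then there is a well-defined bijection $W(\mathcal S)\to\mathcal I(\mathcal S)$, $w\mapsto I_{S_1}I_{S_2}\cdots I_{S_r}$, where $\sigma_{S_1}\sigma_{S_2}\cdots\sigma_{S_r}$ is any reduced expression for $w$, that is, an expression of $w$ as a product of generators with $r$ minimal. -/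

import Mathlib

open CategoryTheory TensorProduct MulOpposite
open scoped ModuleCat

universe w u

/-! ### Bimodules and the Calabi-Yau property

`K` is a field and `A` a `K`-algebra. An `A`-bimodule (on which `K` acts centrally) is a left module
over the enveloping algebra `A ⊗[K] Aᵐᵒᵖ`. -/

section CalabiYau

variable (K : Type w) [Field K] (A : Type u) [Ring A] [Algebra K A]

/-- The enveloping algebra. As a left module over itself it is `A ⊗ A` with the outer bimodule
structure: `(b ⊗ op c) * (x ⊗ op y) = b x ⊗ op (y c)`. -/
abbrev EnvAlg : Type u := A ⊗[K] Aᵐᵒᵖ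

/-- The category of `A`-bimodules. -/
abbrev BimodCat := ModuleCat.{u} (EnvAlg K A)

/-- `A` as a bimodule over itself: `(b ⊗ op c) • x = b x c`. -/
noncomputable def regularBimod : BimodCat K A :=
  letI : Module (EnvAlg K A) A := TensorProduct.Algebra.module
  ModuleCat.of (EnvAlg K A) A

/-- The swap `b ⊗ op c ↦ op (c ⊗ op b)`, an isomorphism of the enveloping algebra with its
opposite. -/
noncomputable def envSwap : EnvAlg K A ≃ₐ[K] (EnvAlg K A)ᵐᵒᵖ :=
  ((Algebra.TensorProduct.comm K A Aᵐᵒᵖ).trans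
    (Algebra.TensorProduct.congr (AlgEquiv.refl (R := K) (A₁ := Aᵐᵒᵖ)) (AlgEquiv.opOp K A))).trans
    (Algebra.TensorProduct.opAlgEquiv K K A Aᵐᵒᵖ)

theorem envSwap_tmul (b c : A) :
    envSwap K A (b ⊗ₜ[K] op c) = op (c ⊗ₜ[K] op b) := by
  simp [envSwap]

/-- The contravariant functor `M ↦ Hom_{AA}(M, A ⊗ A)`, where `Hom_{AA}(M, A ⊗ A)` is a bimodule
through the inner actions: if `f m = ∑ x ⊗ op y` then
`((b ⊗ op c) • f) m = f m * (c ⊗ op b) = ∑ x c ⊗ op (b y)`. -/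
noncomputable def bimodDual : (BimodCat K A)ᵒᵖ ⥤ BimodCat K A where
  obj M := (ModuleCat.restrictScalars (envSwap K A : EnvAlg K A →+* (EnvAlg K A)ᵐᵒᵖ)).obj
    (ModuleCat.of (EnvAlg K A)ᵐᵒᵖ (M.unop →ₗ[EnvAlg K A] EnvAlg K A))
  map φ := (ModuleCat.restrictScalars (envSwap K A : EnvAlg K A →+* (EnvAlg K A)ᵐᵒᵖ)).map
    (ModuleCat.ofHom
      { toFun := fun f => f ∘ₗ φ.unop.hom
        map_add' := fun _ _ => rfl
        map_smul' := fun _ _ => rfl })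
  map_id _ := rfl
  map_comp _ _ := rfl

instance : (bimodDual K A).Additive where
  map_add {M _ φ ψ} := by
    ext (f : M.unop →ₗ[EnvAlg K A] EnvAlg K A)
    exact LinearMap.ext fun m => map_add f (φ.unop.hom m) (ψ.unop.hom m)

variable {K A} in
/-- For a complex `⋯ → P₁ → P₀ → 0` of bimodules, the cochain complex
`0 → Hom_{AA}(P₀, A ⊗ A) → Hom_{AA}(P₁, A ⊗ A) → ⋯` of bimodules, with the first term
in degree `0`. -/
noncomputable def bimodDualComplex (P : ChainComplex (BimodCat K A) ℕ) :
    CochainComplex (BimodCat K A) ℤ :=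
  HomologicalComplex.extend
    ((((bimodDual K A).rightOp.mapHomologicalComplex _).obj P).unop :
      CochainComplex (BimodCat K A) ℕ)
    ComplexShape.embeddingUpNat

/-- `A` is `d`-Calabi-Yau: it is homologically smooth, i.e. it has a projective resolution `P` of
finite length by finitely generated bimodules, and `RHom_{AA}(A, A ⊗ A)`, which is the complex
`Hom_{AA}(P, A ⊗ A)`, is isomorphic to `A[-d]` in the derived category of bimodules.
(As usual the choice of `P` is immaterial, since any two are homotopy equivalent.) -/
def IsCalabiYau (d : ℕ) : Prop :=
  letI : HasDerivedCategory.{u + 1} (BimodCat K A) := HasDerivedCategory.standard _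
  ∃ P : ProjectiveResolution (regularBimod K A),
    (∀ n, Module.Finite (EnvAlg K A) (P.complex.X n)) ∧
    (∃ N, ∀ n, N < n → Limits.IsZero (P.complex.X n)) ∧
    Nonempty (DerivedCategory.Q.obj (bimodDualComplex P.complex) ≅
      (DerivedCategory.singleFunctor (BimodCat K A) (d : ℤ)).obj (regularBimod K A))

end CalabiYau

/-! ### Sets of simple modules, products of annihilators, and the Coxeter group -/

section Ideals

variable {A : Type u} [Ring A]

/-- `I_{S₁} I_{S₂} ⋯ I_{S_r}`, where `I_S` is the annihilator of `S`; it is `A` for the empty list.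
All `I_S` are two-sided; `Ideal A` is the type of left ideals, and the product of
two ideals is the additive span of the products of their elements. -/
noncomputable def annProd {𝒮 : Set (ModuleCat.{u} A)} : List 𝒮 → Ideal A
  | [] => ⊤
  | S :: L => Module.annihilator A S.1 * annProd L

/-- The set of all products of annihilators of finite sequences in `𝒮`. -/
def annProdSet (𝒮 : Set (ModuleCat.{u} A)) : Set (Ideal A) :=
  Set.range (annProd (𝒮 := 𝒮))

/-- The isomorphism classes of modules in `𝒮`. -/
def IsoClass (𝒮 : Set (ModuleCat.{u} A)) : Type (u + 1) :=
  Quotient ((isIsomorphicSetoid (ModuleCat.{u} A)).comap (Subtype.val : 𝒮 → ModuleCat.{u} A))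

/-- The isomorphism class of a module in `𝒮`. -/
def IsoClass.mk {𝒮 : Set (ModuleCat.{u} A)} (S : 𝒮) : IsoClass 𝒮 :=
  Quotient.mk _ S

end Ideals

section Coxeter

variable (K : Type w) [Field K] {A : Type u} [Ring A] [Algebra K A]

/-- The number `dim_K Ext¹_A(S, T)` of arrows from `S` to `T` in the Ext-quiver. -/
noncomputable def numArrows (S T : ModuleCat.{u} A) : Cardinal.{u} :=
  Module.rank K (Abelian.Ext.{u} S T 1)

/-- The defining relators of the Coxeter group of the Ext-quiver of `𝒮`. -/
inductive CoxRel (𝒮 : Set (ModuleCat.{u} A)) : FreeGroup (IsoClass 𝒮) → Prop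
  | sq (S : 𝒮) :
      CoxRel 𝒮 (FreeGroup.of (.mk S) * FreeGroup.of (.mk S))
  | comm (S T : 𝒮) (h : numArrows K S.1 T.1 = 0) :
      CoxRel 𝒮 (FreeGroup.of (.mk S) * FreeGroup.of (.mk T) *
        (FreeGroup.of (.mk T) * FreeGroup.of (.mk S))⁻¹)
  | braid (S T : 𝒮) (h : numArrows K S.1 T.1 = 1) :
      CoxRel 𝒮 (FreeGroup.of (.mk S) * FreeGroup.of (.mk T) * FreeGroup.of (.mk S) *
        (FreeGroup.of (.mk T) * FreeGroup.of (.mk S) * FreeGroup.of (.mk T))⁻¹)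

/-- The Coxeter group `W(𝒮)` of the Ext-quiver of `𝒮`, with one generator for each isomorphism
class in `𝒮`. -/
abbrev CoxGroup (𝒮 : Set (ModuleCat.{u} A)) : Type (u + 1) :=
  PresentedGroup {r | CoxRel K 𝒮 r}

/-- The generator `σ_S`. -/
def coxGen {𝒮 : Set (ModuleCat.{u} A)} (S : 𝒮) : CoxGroup K 𝒮 :=
  PresentedGroup.of (IsoClass.mk S)

/-- `σ_{S₁} σ_{S₂} ⋯ σ_{S_r}` is a reduced expression for `w`: its value is `w`, and no shorter
product of generators has value `w`. -/
def IsReducedExpr {𝒮 : Set (ModuleCat.{u} A)} (L : List 𝒮) (w : CoxGroup K 𝒮) : Prop :=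
  (L.map (coxGen K)).prod = w ∧
    ∀ L' : List 𝒮, (L'.map (coxGen K)).prod = w → L.length ≤ L'.length

end Coxeter

/-! ### Descent systems and Coxeter groups -/

/-! Let `J` be a left ideal of finite codimension with Ext¹(J, J) = 0, and let χ be the Euler form.
The Calabi-Yau property supplies three facts: all modules have projective dimension at most 2, so
`J` has projective dimension at most 1; Hom(N, M) is the dual of Ext²(M, N) for `M`
finite-dimensional and `N` arbitrary (`IsCalabiYau.nonempty_equiv_dual_ext_two`); and χ is symmetric
on finite-dimensional modules (`IsCalabiYau.eulerForm_symm`).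

A nonzero map J → S is onto, so rigidity of `J` gives Ext¹(J, S) = 0 and χ(J, S) = dim Hom(J, S).
Hence the sign of χ(J, S) decides whether I_S J = J. If it is positive, there is an exact sequence 0
→ I_S J → J → S^k → 0 with k = χ(J, S), and passing from `J` to I_S J changes the weights χ(J, T) by
the simple reflection of the Cartan matrix χ(S, T), which is 2 on the diagonal and −dim Ext¹(S, T)
off it. The ideal I_S J is again rigid of finite codimension (`IsRigidIdeal.mul`). By duality `S`
does not embed in A/J, so `J` is determined by I_S J (`IsRigidIdeal.le_of_mul_le`). Computing
weights of products of two or three annihilators shows that one more factor is absorbed, and this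
yields the commutation and braid relations between the I_S.

What remains is combinatorics, isolated in `DescentSystem`. Start from `A`, where all weights are
positive, and consider chains of strictly descending steps labelled by generators. The exchange
property `Chain.exchange` shows that each group element is carried by a chain and that a reduced
word is itself a chain. The endpoint depends only on the group element, because its weights are the
image of the base weights under the geometric representation and weights determine endpoints
(`Chain.eq_of_h_eq`). Conversely the endpoint determines the group element (`Chain.eq_of_eq_left`).
Neither faithfulness of the geometric representation nor the word property of Coxeter groups is
used. -/

/-- A set `X` with idempotent operations `p b` controlled by integer weights `h x b`, which
change under the simple reflections of the symmetric generalized Cartan matrix `C`. -/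
structure DescentSystem (B : Type*) (X : Type*) where
  p : B → X → X
  h : X → B → ℤ
  C : B → B → ℤ
  x₀ : X
  C_symm : ∀ b c, C b c = C c b
  C_self : ∀ b, C b b = 2
  C_nonpos : ∀ b c, b ≠ c → C b c ≤ 0
  h_base : ∀ b, 0 < h x₀ b
  p_of_nonpos : ∀ x b, h x b ≤ 0 → p b x = x
  h_p : ∀ x b, 0 < h x b → ∀ c, h (p b x) c = h x c - h x b * C b c
  p_inj : ∀ x y b, 0 < h x b → 0 < h y b → p b x = p b y → x = y
  p_comm : ∀ b c, C b c = 0 → ∀ x, p b (p c x) = p c (p b x)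
  p_braid : ∀ b c, C b c = -1 → ∀ x, p b (p c (p b x)) = p c (p b (p c x))

/-- Elements `s b` of a group satisfying the Coxeter relations attached to `C`. -/
structure CoxeterElements {B : Type*} (C : B → B → ℤ) (W : Type*) [Group W] where
  s : B → W
  sq : ∀ b, s b * s b = 1
  comm : ∀ b c, C b c = 0 → s b * s c = s c * s b
  braid : ∀ b c, C b c = -1 → s b * s c * s b = s c * s b * s c

namespace DescentSystem

variable {B X W : Type*} [Group W] (D : DescentSystem B X) (S : CoxeterElements D.C W)

lemma h_p_self {x : X} {b : B} (hb : 0 < D.h x b) : D.h (D.p b x) b = - D.h x b := by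
  rw [D.h_p x b hb, D.C_self]; ring

/-- `D.Chain S n x w`: a chain of `n` strictly descending steps from the base point to `x`
whose labels multiply to `w`. -/
inductive Chain : ℕ → X → W → Prop
  | base : Chain 0 D.x₀ 1
  | step {n x w} (b : B) (hb : 0 < D.h x b) (hc : Chain n x w) :
      Chain (n + 1) (D.p b x) (S.s b * w)

variable {D S}

/-- A step at `b` with weight h > 0 replaces the weight at `c` by at least itself plus 2h and
negates the weight at `b`, so the sum does not drop; steps elsewhere only increase it. This keeps
pairs with at least two arrows out of the exchange argument. -/
lemma Chain.sum_pos {n x w} (hx : D.Chain S n x w) {b c : B} (hbc : D.C b c ≤ -2) :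
    0 < D.h x b + D.h x c := by
  induction hx with
  | base => have := D.h_base b; have := D.h_base c; omega
  | @step n x w d hd hx ih =>
    rw [D.h_p _ _ hd, D.h_p _ _ hd]
    by_cases hdb : d = b
    · subst hdb
      rw [D.C_self]; nlinarith
    by_cases hdc : d = c
    · subst hdc
      rw [D.C_self]; rw [D.C_symm] at hbc; nlinarith
    have h1 := D.C_nonpos d b hdb
    have h2 := D.C_nonpos d c hdc
    nlinarith

/-- The exchange property for chains. -/
lemma Chain.exchange {n x w} (hx : D.Chain S n x w) {b : B} (hb : D.h x b ≤ 0) :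
    ∃ m u, n = m + 1 ∧ 0 < D.h u b ∧ D.p b u = x ∧ D.Chain S m u (S.s b * w) := by
  induction n using Nat.strong_induction_on generalizing x w b with
  | _ n ih =>
  cases hx with
  | base => exact absurd (D.h_base b) (by omega)
  | @step n z w c hc hz =>
  by_cases hcb : c = b
  · subst hcb
    refine ⟨n, z, rfl, hc, rfl, ?_⟩
    rwa [← mul_assoc, S.sq, one_mul]
  have hCnp := D.C_nonpos c b hcb
  have hxb := D.h_p z c hc b
  have hxc := D.h_p_self hc
  have hzb : D.h z b ≤ 0 := by nlinarith
  -- The weight of x at c is negative after the step, so `Chain.sum_pos` would make its weight at b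
  -- positive.
  have hC2 : ¬ D.C c b ≤ -2 := by
    intro hC
    have := (hz.step c hc).sum_pos hC
    omega
  obtain ⟨m, y, rfl, hyb, rfl, hy⟩ := ih n (by omega) hz hzb
  have hzc := D.h_p y b hyb c
  rw [D.C_symm b c] at hzc
  have : D.C c b = 0 ∨ D.C c b = -1 := by omega
  rcases this with h0 | h1
  · have h0' : D.C b c = 0 := by rw [D.C_symm, h0]
    have hyc : 0 < D.h y c := by rw [h0] at hzc; omega
    have hb' : 0 < D.h (D.p c y) b := by rw [D.h_p y c hyc, h0]; omega
    refine ⟨m + 1, D.p c y, rfl, hb', D.p_comm b c h0' y, ?_⟩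
    have := hy.step c hyc
    rwa [← mul_assoc, S.comm c b h0, mul_assoc] at this
  · have h1' : D.C b c = -1 := by rw [D.C_symm, h1]
    have hyb' := D.h_p_self hyb
    rw [h1] at hzc hxb
    -- With one arrow between b and c, the weight of x at b equals that of y at c. So exchange
    -- applies a second time, x is a braid word b, c, b applied to v, and the weights of v at b and
    -- c are both positive.
    have hyc : D.h y c ≤ 0 := by
      by_contra hcon
      omega
    obtain ⟨k, v, rfl, hvc, rfl, hv⟩ := ih m (by omega) hy hyc
    have e1 := D.h_p v c hvc b
    have e2 := D.h_p_self hvc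
    rw [h1] at e1
    have hvb : 0 < D.h v b := by omega
    have e3 := D.h_p v b hvb c
    rw [h1'] at e3
    have hvbc : 0 < D.h (D.p b v) c := by omega
    have e4 := D.h_p _ c hvbc b
    have e5 := D.h_p_self hvb
    rw [h1] at e4
    refine ⟨k + 2, D.p c (D.p b v), by omega, by omega, D.p_braid b c h1' v, ?_⟩
    have := (hv.step b hvb).step c hvbc
    have e : S.s c * (S.s b * (S.s c * (S.s b * w))) = S.s b * (S.s c * w) := by
      have := S.braid c b h1
      calc _ = (S.s c * S.s b * S.s c) * (S.s b * w) := by simp only [mul_assoc]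
        _ = S.s b * S.s c * (S.s b * S.s b) * w := by rw [this]; simp only [mul_assoc]
        _ = _ := by rw [S.sq, mul_one, mul_assoc]
    rwa [e] at this

/-- The last label c of one chain has negative weight at x, so exchange makes the other chain end in
c too, and injectivity of `D.p c` cancels it. At the base point all weights are positive, so only
the empty chain ends there. -/
lemma Chain.eq_of_eq_left {n m x w w'} (hx : D.Chain S n x w) (hx' : D.Chain S m x w') :
    w = w' := by
  induction hx' generalizing n w with
  | base =>
    generalize e : D.x₀ = y at hx
    cases hx with
    | base => rfl
    | step b hb hx =>
      have := D.h_p_self hb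
      have h0 := D.h_base b
      rw [← e] at this
      omega
  | @step m z w' c hc hz ih =>
    obtain ⟨k, u, rfl, huc, hu, hchain⟩ := hx.exchange (b := c) (by
      have := D.h_p_self hc; omega)
    obtain rfl := D.p_inj _ _ _ huc hc hu
    rw [← ih hchain, ← mul_assoc, S.sq, one_mul]

/-- Either the step by `b` descends, or exchange cancels a letter. The length bound records that
full length occurs only in the first case. -/
lemma Chain.exists_mul {n x w} (hx : D.Chain S n x w) (b : B) :
    ∃ m y, m ≤ n + 1 ∧ D.Chain S m y (S.s b * w) ∧ (m = n + 1 → y = D.p b x) := by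
  by_cases hb : 0 < D.h x b
  · exact ⟨n + 1, _, le_rfl, hx.step b hb, fun _ => rfl⟩
  · obtain ⟨m, u, rfl, -, -, hu⟩ := hx.exchange (b := b) (by omega)
    exact ⟨m, u, by omega, hu, fun h => by omega⟩

variable (D S) in
-- Reading a word letter by letter, the chain loses length as soon as some letter fails to descend;
-- if no length is lost, its endpoint is the product along the word.
lemma exists_chain_list (L : List B) :
    ∃ m x, m ≤ L.length ∧ D.Chain S m x (L.map S.s).prod ∧
      (m = L.length → x = L.foldr D.p D.x₀) := by
  induction L with
  | nil => exact ⟨0, D.x₀, le_rfl, Chain.base, fun _ => rfl⟩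
  | cons b L ih =>
    obtain ⟨m, x, hm, hx, he⟩ := ih
    obtain ⟨k, y, hk, hy, he'⟩ := hx.exists_mul b
    refine ⟨k, y, by simp; omega, by simpa using hy, fun h => ?_⟩
    simp only [List.length_cons] at h
    rw [he' (by omega), he (by omega)]
    rfl

lemma Chain.exists_list {n x w} (hx : D.Chain S n x w) :
    ∃ L : List B, L.length = n ∧ (L.map S.s).prod = w := by
  induction hx with
  | base => exact ⟨[], rfl, rfl⟩
  | step b hb _ ih =>
    obtain ⟨L, hL, hw⟩ := ih
    exact ⟨b :: L, by simp [hL], by simp [hw]⟩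

variable (D S) in
lemma exists_chain_foldr (L : List B) : ∃ n w, D.Chain S n (L.foldr D.p D.x₀) w := by
  induction L with
  | nil => exact ⟨_, _, Chain.base⟩
  | cons b L ih =>
    obtain ⟨n, w, h⟩ := ih
    by_cases hb : 0 < D.h (L.foldr D.p D.x₀) b
    · exact ⟨_, _, h.step b hb⟩
    · refine ⟨n, w, ?_⟩
      rwa [List.foldr_cons, D.p_of_nonpos _ _ (by omega)]

lemma Chain.h_eq {n x w} (hx : D.Chain S n x w) (ρ : W →* Equiv.Perm (B → ℤ))
    (hρ : ∀ b f c, ρ (S.s b) f c = f c - f b * D.C b c) : D.h x = ρ w (D.h D.x₀) := by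
  induction hx with
  | base => simp
  | step b hb _ ih =>
    ext c
    rw [map_mul, Equiv.Perm.mul_apply, hρ, ← ih, D.h_p _ _ hb]

/-- The last label of a chain is visible in the weights as a negative entry, so both chains can be
shortened by the same label. Undoing a reflection shows that the shortened endpoints still have
equal weights. -/
lemma Chain.eq_of_h_eq {n m x x' w w'} (hx : D.Chain S n x w) (hx' : D.Chain S m x' w')
    (h : D.h x = D.h x') : x = x' := by
  induction hx generalizing m x' w' with
  | base =>
    cases hx' with
    | base => rfl
    | step b hb hx =>
      have := D.h_p_self hb
      rw [← h] at this
      have h0 := D.h_base b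
      omega
  | @step n z w b hb hz ih =>
    have e := D.h_p_self hb
    obtain ⟨k, u, rfl, hub, rfl, hchain⟩ := hx'.exchange (b := b) (by rw [← h]; omega)
    rw [ih hchain]
    have e' := D.h_p_self hub
    ext c
    have hc := congrFun h c
    have hb' := congrFun h b
    rw [D.h_p _ _ hb, D.h_p _ _ hub] at hc
    have : D.h z b = D.h u b := by omega
    rw [this] at hc
    omega

/-- A group generated by Coxeter elements which acts on the weights by simple reflections is in
bijection with the set of points reachable from the base point, through reduced words. -/
theorem exists_bijective (D : DescentSystem B X) (S : CoxeterElements D.C W)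
    (hS : ∀ w : W, ∃ L : List B, (L.map S.s).prod = w)
    (ρ : W →* Equiv.Perm (B → ℤ)) (hρ : ∀ b f c, ρ (S.s b) f c = f c - f b * D.C b c) :
    ∃ f : W → Set.range (fun L : List B => L.foldr D.p D.x₀),
      (∀ L : List B, (∀ L' : List B, (L'.map S.s).prod = (L.map S.s).prod →
        L.length ≤ L'.length) → (f (L.map S.s).prod : X) = L.foldr D.p D.x₀) ∧
      Function.Bijective f := by
  have key : ∀ w : W, ∃ x : Set.range (fun L : List B => L.foldr D.p D.x₀),
      ∃ n, D.Chain S n x w := by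
    intro w
    obtain ⟨L, rfl⟩ := hS w
    obtain ⟨m, x, -, hx, -⟩ := D.exists_chain_list S L
    refine ⟨⟨x, ?_⟩, m, hx⟩
    clear * - hx
    generalize (L.map S.s).prod = w at hx
    induction hx with
    | base => exact ⟨[], rfl⟩
    | step b hb _ ih =>
      obtain ⟨L, rfl⟩ := ih
      exact ⟨b :: L, rfl⟩
  choose f n hf using key
  have uniq : ∀ {w m x}, D.Chain S m x w → (f w : X) = x := fun hx =>
    (hf _).eq_of_h_eq hx (by rw [(hf _).h_eq ρ hρ, hx.h_eq ρ hρ])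
  refine ⟨f, fun L hL => ?_, fun w w' h => ?_, fun ⟨x, L, hL⟩ => ?_⟩
  · obtain ⟨m, x, hm, hx, he⟩ := D.exists_chain_list S L
    obtain ⟨L', hL', hw⟩ := hx.exists_list
    -- The chain itself spells a word of its own length, so minimality of L forces the chain to have
    -- length exactly that of L.
    have := hL L' hw
    rw [uniq hx, he (by omega)]
  · have h1 := hf w
    rw [h] at h1
    exact h1.eq_of_eq_left (hf w')
  · obtain ⟨n, w, h⟩ := D.exists_chain_foldr S L
    exact ⟨w, Subtype.ext (by rw [uniq h]; exact hL)⟩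

end DescentSystem

/-! ### The dual complex of a bimodule resolution -/

section DualComplex

variable {K : Type w} [Field K] {A : Type u} [Ring A] [Algebra K A]

/-- The cochain complex `Hom_{AA}(P, A ⊗ A)` indexed by `ℕ`. -/
noncomputable abbrev natDualComplex (P : ChainComplex (BimodCat K A) ℕ) :
    CochainComplex (BimodCat K A) ℕ :=
  (((bimodDual K A).rightOp.mapHomologicalComplex _).obj P).unop

/-- The isomorphism in the derived category is needed only through homology; extending the complex
to the integers by zero does not change it. -/
lemma natDualComplex_homology (P : ChainComplex (BimodCat K A) ℕ) (d : ℕ)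
    (e : letI : HasDerivedCategory.{u + 1} (BimodCat K A) := HasDerivedCategory.standard _
      Nonempty (DerivedCategory.Q.obj (bimodDualComplex P) ≅
      (DerivedCategory.singleFunctor (BimodCat K A) (d : ℤ)).obj (regularBimod K A))) :
    (∀ n, n ≠ d → (natDualComplex P).ExactAt n) ∧
      Nonempty ((natDualComplex P).homology d ≅ regularBimod K A) := by
  let : HasDerivedCategory.{u + 1} (BimodCat K A) := HasDerivedCategory.standard _
  obtain ⟨e⟩ := e
  have e' : ∀ n : ℤ, Nonempty ((bimodDualComplex P).homology n ≅
      ((HomologicalComplex.single (BimodCat K A) (ComplexShape.up ℤ) (d : ℤ)).obj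
        (regularBimod K A)).homology n) := fun n =>
    ⟨((DerivedCategory.homologyFunctorFactors (BimodCat K A) n).app _).symm ≪≫
      (DerivedCategory.homologyFunctor _ n).mapIso e ≪≫
      (DerivedCategory.homologyFunctorFactors (BimodCat K A) n).app _⟩
  constructor
  · intro n hn
    obtain ⟨e⟩ := e' n
    rw [← HomologicalComplex.extend_exactAt_iff (natDualComplex P) ComplexShape.embeddingUpNat
      (j := n) (j' := (n : ℤ)) rfl, HomologicalComplex.exactAt_iff_isZero_homology]
    exact (HomologicalComplex.isZero_single_obj_homology _ _ _ _
      (by exact_mod_cast hn)).of_iso e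
  · obtain ⟨e⟩ := e' d
    exact ⟨(HomologicalComplex.extendHomologyIso (natDualComplex P) ComplexShape.embeddingUpNat
      (j := d) (j' := (d : ℤ)) rfl).symm ≪≫ e ≪≫
      HomologicalComplex.singleObjHomologySelfIso _ _ _⟩

end DualComplex

/-! ### Splitting off the end of a complex of projectives -/

section Splitting

/-- Split a surjection from a finite free module; the functionals are the coordinates of the
splitting. -/
lemma Module.exists_dualBasis (R P : Type*) [Ring R] [AddCommGroup P] [Module R P]
    [Module.Finite R P] [Module.Projective R P] :
    ∃ (n : ℕ) (p : Fin n → P) (ξ : Fin n → P →ₗ[R] R), ∀ x, ∑ j, ξ j x • p j = x := by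
  obtain ⟨n, f, hf⟩ := Module.Finite.exists_fin' R P
  obtain ⟨g, hg⟩ := Module.projective_lifting_property f LinearMap.id hf
  refine ⟨n, fun j => f fun i => if j = i then 1 else 0, fun j => LinearMap.proj j ∘ₗ g,
    fun x => ?_⟩
  exact (f.pi_apply_eq_sum_univ (g x)).symm.trans (LinearMap.congr_fun hg x)

variable {R : Type*} [Ring R]

/-- Extending the functionals of a dual basis of `Q` along `j` assembles a retraction of `j`, so the
cokernel is a summand of `P`. -/
lemma Module.Projective.quotient_range_of_extends {P Q : Type*} [AddCommGroup P] [Module R P]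
    [AddCommGroup Q] [Module R Q] [Module.Finite R Q] [Module.Projective R Q]
    [Module.Projective R P] (j : Q →ₗ[R] P)
    (h : ∀ ξ : Q →ₗ[R] R, ∃ χ : P →ₗ[R] R, χ ∘ₗ j = ξ) :
    Module.Projective R (P ⧸ LinearMap.range j) := by
  obtain ⟨n, q, ξ, hq⟩ := Module.exists_dualBasis R Q
  choose χ hχ using fun i => h (ξ i)
  let r : P →ₗ[R] Q := ∑ i, (χ i).smulRight (q i)
  have hr : ∀ y, r (j y) = y := fun y => by
    conv_rhs => rw [← hq y]
    simp only [r, LinearMap.sum_apply, LinearMap.smulRight_apply]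
    exact Finset.sum_congr rfl fun i _ => by rw [← hχ i]; rfl
  refine Module.Projective.of_split
    ((LinearMap.range j).liftQ (LinearMap.id - j ∘ₗ r) ?_) (LinearMap.range j).mkQ ?_
  · rintro _ ⟨y, rfl⟩
    simp [hr]
  · ext x
    simp

/-- Descending induction from the zero end of the complex. A functional on the next cokernel is a
functional on X (n + 1) killed by the differential; dual exactness extends it to X n, so that
cokernel splits off X n. -/
lemma Module.Projective.quotient_range_of_dual_exact {X : ℕ → Type*} [∀ n, AddCommGroup (X n)]
    [∀ n, Module R (X n)] [∀ n, Module.Finite R (X n)] [∀ n, Module.Projective R (X n)]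
    (d : ∀ n, X (n + 1) →ₗ[R] X n) (hd : ∀ n, Function.Exact (d (n + 1)) (d n)) (N m : ℕ)
    (hN : ∀ n, N < n → Subsingleton (X n))
    (hdual : ∀ n, m ≤ n → ∀ ψ : X (n + 1) →ₗ[R] R, ψ ∘ₗ d (n + 1) = 0 →
      ∃ χ : X n →ₗ[R] R, χ ∘ₗ d n = ψ) :
    ∀ n, m ≤ n → Module.Projective R (X n ⧸ LinearMap.range (d n)) := by
  have main : ∀ k n, m ≤ n → N < n + k → Module.Projective R (X n ⧸ LinearMap.range (d n)) := by
    intro k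
    induction k with
    | zero =>
      intro n _ hn
      have := hN n hn
      have : Subsingleton (X n ⧸ LinearMap.range (d n)) :=
        (Submodule.mkQ_surjective _).subsingleton
      infer_instance
    | succ k ih =>
      intro n hn hk
      have := ih (n + 1) (by omega) (by omega)
      let j : X (n + 1) ⧸ LinearMap.range (d (n + 1)) →ₗ[R] X n :=
        (LinearMap.range (d (n + 1))).liftQ (d n) (by
          rintro _ ⟨y, rfl⟩
          exact (hd n).apply_apply_eq_zero y)
      have hj : LinearMap.range j = LinearMap.range (d n) := Submodule.range_liftQ _ _ _
      rw [← hj]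
      refine Module.Projective.quotient_range_of_extends j fun ξ => ?_
      obtain ⟨χ, hχ⟩ := hdual n hn (ξ ∘ₗ (LinearMap.range (d (n + 1))).mkQ) (by
        ext y
        exact (congrArg ξ ((Submodule.Quotient.mk_eq_zero _).2 ⟨y, rfl⟩)).trans (map_zero ξ))
      exact ⟨χ, Submodule.linearMap_qext _ (by rw [← hχ]; ext; simp [j])⟩
  exact fun n hn => main (N + 1) n hn (by omega)

end Splitting

/-! ### Bimodule resolutions of length two -/

section BimodResolution

variable {K : Type w} [Field K] {A : Type u} [Ring A] [Algebra K A]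

/-- The bimodule `Hom_{AA}(P, A ⊗ A)`. -/
noncomputable abbrev dualBimod (P : BimodCat K A) : BimodCat K A :=
  (bimodDual K A).obj (Opposite.op P)

/-- The transpose of a bimodule homomorphism. -/
noncomputable abbrev dualBimodMap {P Q : BimodCat K A} (f : P ⟶ Q) :
    dualBimod Q ⟶ dualBimod P :=
  (bimodDual K A).map f.op

lemma dualBimod_smul_apply {P : BimodCat K A} (e : EnvAlg K A)
    (ξ : P →ₗ[EnvAlg K A] EnvAlg K A) (x : P) :
    (show P →ₗ[EnvAlg K A] EnvAlg K A from (e • (show dualBimod P from ξ) : dualBimod P)) x =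
      ξ x * (envSwap K A e).unop := rfl

/-- `0 → P₂ → P₁ → P₀ → A → 0` is a projective resolution of the bimodule `A`. -/
structure IsBimodResolution {P₂ P₁ P₀ : BimodCat K A} (d₂ : P₂ ⟶ P₁) (d₁ : P₁ ⟶ P₀)
    (ε : P₀ ⟶ regularBimod K A) : Prop where
  projective₂ : Module.Projective (EnvAlg K A) P₂
  projective₁ : Module.Projective (EnvAlg K A) P₁
  projective₀ : Module.Projective (EnvAlg K A) P₀
  injective : Function.Injective d₂.hom
  exact₁ : Function.Exact d₂.hom d₁.hom
  exact₀ : Function.Exact d₁.hom ε.hom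
  surjective : Function.Surjective ε.hom

/-- Evaluation on a dual basis of `P` exhibits the dual as a retract of a free bimodule; `envSwap`
turns the inner right multiplication into a left one. -/
lemma dualBimod_projective (P : BimodCat K A) [Module.Finite (EnvAlg K A) P]
    [Module.Projective (EnvAlg K A) P] : Module.Projective (EnvAlg K A) (dualBimod P) := by
  obtain ⟨n, p, ξ, hp⟩ := Module.exists_dualBasis (EnvAlg K A) P
  let i : dualBimod P →ₗ[EnvAlg K A] (Fin n → EnvAlg K A) :=
    { toFun := fun η j =>
        (envSwap K A).symm (op ((show P →ₗ[EnvAlg K A] EnvAlg K A from η) (p j)))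
      map_add' := fun η θ => by
        ext j
        exact map_add (envSwap K A).symm (op _) (op _)
      map_smul' := fun e η => by
        ext j
        refine (congrArg (envSwap K A).symm (?_ : _ =
          envSwap K A e * op ((show P →ₗ[EnvAlg K A] EnvAlg K A from η) (p j)))).trans ?_
        · rfl
        · rw [map_mul, AlgEquiv.symm_apply_apply]; rfl }
  let s : (Fin n → EnvAlg K A) →ₗ[EnvAlg K A] dualBimod P :=
    ∑ j, (LinearMap.proj j).smulRight (show dualBimod P from ξ j)
  refine Module.Projective.of_split i s (LinearMap.ext fun η => ?_)
  refine LinearMap.ext (σ := RingHom.id (EnvAlg K A)) (M := P) (M₃ := EnvAlg K A) fun x => ?_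
  have h1 : s (i η) = ∑ j, i η j • (show dualBimod P from ξ j) := by
    simp only [s, LinearMap.sum_apply]; rfl
  let ev : dualBimod P →+ EnvAlg K A :=
    { toFun := fun η => (show P →ₗ[EnvAlg K A] EnvAlg K A from η) x
      map_zero' := rfl
      map_add' := fun _ _ => rfl }
  change ev (s (i η)) = (show P →ₗ[EnvAlg K A] EnvAlg K A from η) x
  rw [h1, map_sum]
  have h2 : ∀ j, ev (i η j • (show dualBimod P from ξ j)) =
      ξ j x * (show P →ₗ[EnvAlg K A] EnvAlg K A from η) (p j) := fun j => by
    refine (dualBimod_smul_apply (i η j) (ξ j) x).trans ?_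
    simp [i]
  rw [Finset.sum_congr rfl fun j _ => h2 j]
  conv_rhs => rw [← hp x, map_sum]
  exact Finset.sum_congr rfl fun j _ => by rw [map_smul, smul_eq_mul]

lemma CategoryTheory.ProjectiveResolution.function_exact_succ {M : BimodCat K A}
    (P : ProjectiveResolution M) (n : ℕ) :
    Function.Exact (P.complex.d (n + 2) (n + 1)).hom (P.complex.d (n + 1) n).hom :=
  (ShortComplex.ShortExact.moduleCat_exact_iff_function_exact _).1 (P.exact_succ n)

lemma CategoryTheory.ProjectiveResolution.exists_augmentation {M : BimodCat K A}
    (P : ProjectiveResolution M) :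
    ∃ ε : P.complex.X 0 ⟶ M, Function.Exact (P.complex.d 1 0).hom ε.hom ∧
      Function.Surjective ε.hom := by
  refine ⟨P.π.f 0, ?_, ?_⟩
  · exact (ShortComplex.ShortExact.moduleCat_exact_iff_function_exact _).1
      (ShortComplex.exact_of_g_is_cokernel
        (ShortComplex.mk _ _ P.complex_d_comp_π_f_zero) P.isColimitCokernelCofork)
  · have : Epi (P.π.f 0) := inferInstance
    exact (ModuleCat.epi_iff_surjective _).1 this

lemma CategoryTheory.ShortComplex.exists_linearMap_of_homology_iso {R : Type*} [Ring R]
    (S : ShortComplex (ModuleCat.{u} R)) {Z : ModuleCat.{u} R} (e : S.homology ≅ Z) :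
    ∃ π : LinearMap.ker S.g.hom →ₗ[R] Z, Function.Surjective π ∧
      ∀ x, π x = 0 ↔ ∃ y, S.f.hom y = x := by
  let e' : (LinearMap.ker S.g.hom ⧸ LinearMap.range S.moduleCatToCycles) ≃ₗ[R] Z :=
    (S.moduleCatHomologyIso.symm ≪≫ e).toLinearEquiv
  refine ⟨e'.toLinearMap ∘ₗ Submodule.mkQ _,
    e'.surjective.comp (Submodule.mkQ_surjective _), fun x => ?_⟩
  rw [LinearMap.comp_apply, LinearEquiv.coe_coe, LinearEquiv.map_eq_zero_iff, Submodule.mkQ_apply,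
    Submodule.Quotient.mk_eq_zero, LinearMap.mem_range]
  exact exists_congr fun y => Subtype.ext_iff

/-- The data extracted from the definition of a Calabi-Yau algebra in terms of elements. -/
lemma IsCalabiYau.exists_complex {m : ℕ} (hA : IsCalabiYau K A (m + 1)) :
    ∃ (X : ℕ → BimodCat K A) (d : ∀ n, X (n + 1) ⟶ X n) (ε : X 0 ⟶ regularBimod K A) (N : ℕ)
      (π : LinearMap.ker (dualBimodMap (d (m + 1))).hom →ₗ[EnvAlg K A] regularBimod K A),
      (∀ n, Module.Finite (EnvAlg K A) (X n)) ∧ (∀ n, Module.Projective (EnvAlg K A) (X n)) ∧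
      (∀ n, Function.Exact (d (n + 1)).hom (d n).hom) ∧
      Function.Exact (d 0).hom ε.hom ∧ Function.Surjective ε.hom ∧
      (∀ n, N < n → Subsingleton (X n)) ∧
      Function.Injective (dualBimodMap (d 0)).hom ∧
      (∀ n, n ≠ m → Function.Exact (dualBimodMap (d n)).hom (dualBimodMap (d (n + 1))).hom) ∧
      Function.Surjective π ∧ ∀ x, π x = 0 ↔ ∃ y, (dualBimodMap (d m)).hom y = x := by
  obtain ⟨P, hfin, ⟨N, hN⟩, e⟩ := hA
  obtain ⟨hexact, ⟨e⟩⟩ := natDualComplex_homology P.complex (m + 1) e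
  obtain ⟨ε, hε, hε'⟩ := P.exists_augmentation
  have hi := (natDualComplex P.complex).isoSc' m (m + 1) (m + 2) (by simp) (by simp)
  obtain ⟨π, hπ, hπ'⟩ := ShortComplex.exists_linearMap_of_homology_iso
    ((natDualComplex P.complex).sc' m (m + 1) (m + 2))
    ((ShortComplex.homologyMapIso hi).symm ≪≫ e)
  refine ⟨P.complex.X, fun n => P.complex.d (n + 1) n, ε, N, π, hfin, fun n =>
    (IsProjective.iff_projective _).2 (P.projective n), fun n => P.function_exact_succ n,
    hε, hε', fun n hn => ModuleCat.subsingleton_of_isZero (hN n hn), ?_, fun n hn => ?_, hπ, hπ'⟩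
  · have h := hexact 0 (by omega)
    rw [HomologicalComplex.exactAt_iff' _ 0 0 1 (by simp) (by simp),
      ShortComplex.moduleCat_exact_iff] at h
    refine (injective_iff_map_eq_zero _).2 fun ψ hψ => ?_
    obtain ⟨χ, hχ⟩ := h ψ hψ
    rw [← hχ]
    have : ((natDualComplex P.complex).sc' 0 0 1).f = 0 :=
      (natDualComplex P.complex).shape 0 0 (by simp)
    rw [this]
    rfl
  · have h := hexact (n + 1) (by omega)
    rw [HomologicalComplex.exactAt_iff' _ n (n + 1) (n + 2) (by simp) (by simp)] at h
    exact (ShortComplex.ShortExact.moduleCat_exact_iff_function_exact _).1 h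

end BimodResolution

/-! ### Truncating the Calabi-Yau resolution to length two. -/

section BimodResolution

variable {K : Type w} [Field K] {A : Type u} [Ring A] [Algebra K A]

/-- The bimodule `A` has a projective resolution `0 → P₂ → P₁ → P₀ → A → 0` by finitely
generated bimodules whose dual is again a resolution of `A`. -/
theorem IsCalabiYau.exists_resolution (hA : IsCalabiYau K A 2) :
    ∃ (P₂ P₁ P₀ : BimodCat K A) (d₂ : P₂ ⟶ P₁) (d₁ : P₁ ⟶ P₀) (ε : P₀ ⟶ regularBimod K A)
      (ε' : dualBimod P₂ ⟶ regularBimod K A),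
      Module.Finite (EnvAlg K A) P₂ ∧ Module.Finite (EnvAlg K A) P₁ ∧
      Module.Finite (EnvAlg K A) P₀ ∧ IsBimodResolution d₂ d₁ ε ∧
      IsBimodResolution (dualBimodMap d₁) (dualBimodMap d₂) ε' := by
  obtain ⟨X, d, ε, N, π, hfin, hproj, hex, hε, hε', hN, hinj, hdual, hπ, hπ'⟩ :=
    IsCalabiYau.exists_complex (m := 1) hA
  -- The dual complex is exact above degree two, so the resolution splits there and may be cut off
  -- at the cokernel of `d 2`.
  have hL : Module.Projective (EnvAlg K A) (X 2 ⧸ LinearMap.range (d 2).hom) :=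
    Module.Projective.quotient_range_of_dual_exact (R := EnvAlg K A) (X := fun n => X n)
      (fun n => (d n).hom) hex N 2 hN
      (fun n hn ψ hψ => (hdual n (by omega) ψ).1 hψ) 2 le_rfl
  obtain ⟨L, q, j, hq, hq0, hjq, hLfin, hLproj⟩ : ∃ (L : BimodCat K A) (q : X 2 ⟶ L)
      (j : L ⟶ X 1), Function.Surjective q.hom ∧
      (∀ x, q.hom x = 0 ↔ x ∈ LinearMap.range (d 2).hom) ∧
      (∀ x, j.hom (q.hom x) = (d 1).hom x) ∧ Module.Finite (EnvAlg K A) L ∧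
      Module.Projective (EnvAlg K A) L :=
    ⟨ModuleCat.of _ (X 2 ⧸ LinearMap.range (d 2).hom),
      ModuleCat.ofHom (LinearMap.range (d 2).hom).mkQ,
      ModuleCat.ofHom ((LinearMap.range (d 2).hom).liftQ (d 1).hom (by
        rintro _ ⟨y, rfl⟩
        exact (hex 1).apply_apply_eq_zero y)),
      Submodule.mkQ_surjective _, fun x => Submodule.Quotient.mk_eq_zero _, fun x => rfl,
      inferInstanceAs (Module.Finite (EnvAlg K A) (X 2 ⧸ LinearMap.range (d 2).hom)), hL⟩
  have hqq : ∀ ξ : dualBimod L,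
      (dualBimodMap q).hom ξ ∈ LinearMap.ker (dualBimodMap (d 2)).hom := by
    intro ξ
    refine LinearMap.ext (M := X 3) (M₃ := EnvAlg K A) (σ := RingHom.id _) fun x => ?_
    have h : q.hom ((d 2).hom x) = 0 := (hq0 _).2 ⟨x, rfl⟩
    exact (congrArg (show L →ₗ[EnvAlg K A] EnvAlg K A from ξ) h).trans (map_zero _)
  -- The dual of the cokernel of `d 2` is the kernel of its transpose. Through κ the degree-two
  -- homology, which is A, becomes the cokernel of the transpose of j.
  let κ : dualBimod L →ₗ[EnvAlg K A] LinearMap.ker (dualBimodMap (d 2)).hom :=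
    (dualBimodMap q).hom.codRestrict _ hqq
  have hκi : Function.Injective κ := fun ξ η h => by
    refine LinearMap.ext (M := L) (M₃ := EnvAlg K A) (σ := RingHom.id _) fun x => ?_
    obtain ⟨x, rfl⟩ := hq x
    exact LinearMap.congr_fun (M := X 2) (M₃ := EnvAlg K A) (σ := RingHom.id _)
      (congrArg Subtype.val h) x
  have hκs : Function.Surjective κ := fun ⟨ψ, hψ⟩ => by
    have hψ' : ∀ x y, q.hom x = q.hom y → (show X 2 →ₗ[EnvAlg K A] EnvAlg K A from ψ) x =
        (show X 2 →ₗ[EnvAlg K A] EnvAlg K A from ψ) y := by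
      intro x y h
      rw [← sub_eq_zero, ← map_sub, hq0] at h
      obtain ⟨z, hz⟩ := h
      rw [← sub_eq_zero, ← map_sub, ← hz]
      exact LinearMap.congr_fun (M := X 3) (M₃ := EnvAlg K A) (σ := RingHom.id _) hψ z
    let ξ : L →ₗ[EnvAlg K A] EnvAlg K A :=
      { toFun := fun y => (show X 2 →ₗ[EnvAlg K A] EnvAlg K A from ψ) (hq y).choose
        map_add' := fun x y => by
          rw [← map_add]
          refine hψ' _ _ ?_
          rw [map_add, (hq x).choose_spec, (hq y).choose_spec, (hq (x + y)).choose_spec]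
        map_smul' := fun e x => by
          rw [RingHom.id_apply, ← map_smul]
          refine hψ' _ _ ?_
          rw [map_smul, (hq x).choose_spec, (hq (e • x)).choose_spec] }
    refine ⟨ξ, Subtype.ext (LinearMap.ext (M := X 2) (M₃ := EnvAlg K A)
      (σ := RingHom.id _) fun x => ?_)⟩
    exact hψ' _ _ (hq (q.hom x)).choose_spec
  have hκj : ∀ χ : dualBimod (X 1), (κ ((dualBimodMap j).hom χ)).1 =
      (dualBimodMap (d 1)).hom χ := fun χ => by
    refine LinearMap.ext (M := X 2) (M₃ := EnvAlg K A) (σ := RingHom.id _) fun x => ?_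
    exact congrArg (show X 1 →ₗ[EnvAlg K A] EnvAlg K A from χ) (hjq x)
  refine ⟨L, X 1, X 0, j, d 0, ε, ModuleCat.homEquiv.symm (π ∘ₗ κ), hLfin, hfin 1, hfin 0,
    ⟨hLproj, hproj 1, hproj 0, ?_, ?_, hε, hε'⟩,
    ⟨@dualBimod_projective K _ A _ _ (X 0) (hfin 0) (hproj 0),
      @dualBimod_projective K _ A _ _ (X 1) (hfin 1) (hproj 1), dualBimod_projective L,
      hinj, ?_, ?_, hπ.comp hκs⟩⟩
  · refine (injective_iff_map_eq_zero _).2 fun x hx => ?_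
    obtain ⟨x, rfl⟩ := hq x
    rw [hjq] at hx
    exact (hq0 x).2 ((hex 1 x).1 hx)
  · intro x
    rw [hex 0 x]
    constructor
    · rintro ⟨y, rfl⟩; exact ⟨q.hom y, hjq y⟩
    · rintro ⟨y, rfl⟩
      obtain ⟨y, rfl⟩ := hq y
      exact ⟨y, (hjq y).symm⟩
  · intro χ
    rw [← hdual 0 (by omega) χ, ← hκj, ZeroMemClass.coe_eq_zero, map_eq_zero_iff κ hκi]
  · intro ξ
    change π (κ ξ) = 0 ↔ _
    rw [hπ']
    refine exists_congr fun χ => ?_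
    rw [← hκj, Subtype.coe_inj, hκi.eq_iff]

end BimodResolution

/-! ### Tensoring bimodules with modules -/

section BimodTensor

variable {K : Type w} [Field K] {A : Type u} [Ring A] [Algebra K A]

@[elab_as_elim]
lemma envAlg_induction {p : EnvAlg K A → Prop} (e : EnvAlg K A) (zero : p 0)
    (tmul : ∀ b c : A, p (b ⊗ₜ[K] op c)) (add : ∀ x y, p x → p y → p (x + y)) : p e :=
  TensorProduct.induction_on e zero (fun b c => tmul b c.unop) add

/-- The left action of `A` on a bimodule. -/
@[reducible] noncomputable def bimodLeftModule (Q : BimodCat K A) : Module A Q :=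
  Module.compHom Q (Algebra.TensorProduct.includeLeftRingHom : A →+* EnvAlg K A)

attribute [local instance] bimodLeftModule

lemma bimod_left_smul_def {Q : BimodCat K A} (a : A) (q : Q) :
    a • q = (a ⊗ₜ[K] (1 : Aᵐᵒᵖ) : EnvAlg K A) • q := rfl

/-- The right action of `A` on a bimodule. -/
noncomputable def bimodRight {Q : BimodCat K A} (q : Q) (a : A) : Q :=
  ((1 : A) ⊗ₜ[K] op a : EnvAlg K A) • q

instance bimod_isScalarTower (Q : BimodCat K A) : IsScalarTower K A Q where
  smul_assoc k a q := by
    rw [bimod_left_smul_def, bimod_left_smul_def, ← smul_assoc, TensorProduct.smul_tmul']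

instance bimod_smulCommClass (Q : BimodCat K A) : SMulCommClass K A Q where
  smul_comm k a q := by
    rw [bimod_left_smul_def, bimod_left_smul_def, ← algebraMap_smul (EnvAlg K A) k,
      ← algebraMap_smul (EnvAlg K A) k, smul_smul, smul_smul, Algebra.commutes]

lemma tmul_smul_eq {Q : BimodCat K A} (b c : A) (q : Q) :
    (b ⊗ₜ[K] op c : EnvAlg K A) • q = b • bimodRight q c := by
  rw [bimod_left_smul_def, bimodRight, smul_smul, Algebra.TensorProduct.tmul_mul_tmul, mul_one,
    one_mul]

lemma bimodRight_left_smul {Q : BimodCat K A} (b c : A) (q : Q) :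
    bimodRight (b • q) c = b • bimodRight q c := by
  rw [← tmul_smul_eq, bimodRight, bimod_left_smul_def, smul_smul,
    Algebra.TensorProduct.tmul_mul_tmul, mul_one, one_mul]

/-- The left action of `A` on `Hom_K(M, N)`. -/
noncomputable def homLeftHom (M N : ModuleCat.{u} A) : A →ₐ[K] Module.End K (M →ₗ[K] N) where
  toFun b := (Algebra.lsmul K K N b).compRight K
  map_one' := by ext; simp
  map_mul' _ _ := by ext; simp
  map_zero' := by ext; simp
  map_add' _ _ := by ext; simp
  commutes' k := by ext; simp

/-- The right action of `A` on `Hom_K(M, N)`. -/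
noncomputable def homRightHom (M N : ModuleCat.{u} A) : Aᵐᵒᵖ →ₐ[K] Module.End K (M →ₗ[K] N) where
  toFun c := (Algebra.lsmul K K M c.unop).lcomp K N
  map_one' := by ext; simp
  map_mul' _ _ := by ext; simp
  map_zero' := by ext; simp
  map_add' _ _ := by ext; simp
  commutes' k := by ext; simp

lemma commute_homLeftHom (M N : ModuleCat.{u} A) (b : A) (c : Aᵐᵒᵖ) :
    Commute (homLeftHom (K := K) M N b) (homRightHom M N c) := rfl

/-- The action of the enveloping algebra on `Hom_K(M, N)`. -/
noncomputable def homEnvHom (M N : ModuleCat.{u} A) :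
    EnvAlg K A →ₐ[K] Module.End K (M →ₗ[K] N) :=
  Algebra.TensorProduct.lift (homLeftHom M N) (homRightHom M N) (commute_homLeftHom M N)

/-- The bimodule structure on `Hom_K(M, N)`. -/
@[reducible] noncomputable def homEnvModule (M N : ModuleCat.{u} A) :
    Module (EnvAlg K A) (M →ₗ[K] N) :=
  Module.compHom _ (homEnvHom M N).toRingHom

attribute [local instance] homEnvModule

lemma homEnv_smul_apply {M N : ModuleCat.{u} A} (b c : A) (f : M →ₗ[K] N) (m : M) :
    ((b ⊗ₜ[K] op c : EnvAlg K A) • f) m = b • f (c • m) := by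
  change (homEnvHom M N (b ⊗ₜ[K] op c)) f m = _
  rw [homEnvHom, Algebra.TensorProduct.lift_tmul]
  rfl

instance homEnv_smulCommClass (M N : ModuleCat.{u} A) :
    SMulCommClass (EnvAlg K A) K (M →ₗ[K] N) where
  smul_comm e k f := map_smul (homEnvHom M N e) k f

variable (K) in
/-- The relations `q a ⊗ m = q ⊗ a m`. -/
noncomputable def tensorRel (Q : BimodCat K A) (M : ModuleCat.{u} A) : Submodule A (Q ⊗[K] M) :=
  Submodule.span A {x | ∃ (q : Q) (a : A) (m : M), x = bimodRight q a ⊗ₜ[K] m - q ⊗ₜ[K] (a • m)}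

/-- The left module `Q ⊗_A M`. -/
noncomputable def bimodTensor (Q : BimodCat K A) (M : ModuleCat.{u} A) : ModuleCat.{u} A :=
  ModuleCat.of A ((Q ⊗[K] M) ⧸ tensorRel K Q M)

/-- The quotient map onto `Q ⊗_A M`. -/
noncomputable def bimodTensorMk (Q : BimodCat K A) (M : ModuleCat.{u} A) :
    Q ⊗[K] M →ₗ[A] bimodTensor Q M := (tensorRel K Q M).mkQ

lemma bimodTensorMk_surjective (Q : BimodCat K A) (M : ModuleCat.{u} A) :
    Function.Surjective (bimodTensorMk Q M) := Submodule.mkQ_surjective _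

lemma bimodTensorMk_eq_zero {Q : BimodCat K A} {M : ModuleCat.{u} A} {x : Q ⊗[K] M} :
    bimodTensorMk Q M x = 0 ↔ x ∈ tensorRel K Q M := Submodule.Quotient.mk_eq_zero _

lemma bimodTensorMk_right (Q : BimodCat K A) (M : ModuleCat.{u} A) (q : Q) (a : A) (m : M) :
    bimodTensorMk Q M (bimodRight q a ⊗ₜ[K] m) = bimodTensorMk Q M (q ⊗ₜ[K] (a • m)) := by
  rw [← sub_eq_zero, ← map_sub, bimodTensorMk_eq_zero]
  exact Submodule.subset_span ⟨q, a, m, rfl⟩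

/-- The homomorphism of bimodules `Q → Hom_K(M, N)` attached to `Q ⊗_A M → N`. -/
noncomputable def bimodTensorCurry {Q : BimodCat K A} {M N : ModuleCat.{u} A}
    (f : bimodTensor Q M →ₗ[A] N) : Q →ₗ[EnvAlg K A] (M →ₗ[K] N) where
  toFun q :=
    { toFun := fun m => f (bimodTensorMk Q M (q ⊗ₜ m))
      map_add' := fun _ _ => by rw [TensorProduct.tmul_add, map_add, map_add]
      map_smul' := fun k m => by
        rw [TensorProduct.tmul_smul, RingHom.id_apply, ← algebraMap_smul A k,
          ← algebraMap_smul A k, map_smul, map_smul] }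
  map_add' _ _ := by ext; simp [TensorProduct.add_tmul]
  map_smul' e q := by
    ext m
    induction e using envAlg_induction with
    | zero =>
      have h₁ : (0 : EnvAlg K A) • q = 0 := zero_smul (EnvAlg K A) q
      have h₂ : ∀ g : M →ₗ[K] N, (0 : EnvAlg K A) • g = 0 := fun g => zero_smul (EnvAlg K A) g
      rw [h₁, RingHom.id_apply, h₂]
      simp
    | add x y hx hy =>
      simp only [add_smul, TensorProduct.add_tmul, map_add, LinearMap.coe_mk, AddHom.coe_mk,
        RingHom.id_apply, LinearMap.add_apply] at hx hy ⊢
      rw [hx, hy]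
    | tmul b c =>
      rw [RingHom.id_apply, homEnv_smul_apply]
      simp only [LinearMap.coe_mk, AddHom.coe_mk]
      rw [tmul_smul_eq, ← TensorProduct.smul_tmul', map_smul, map_smul, bimodTensorMk_right]

/-- The homomorphism `Q ⊗_A M → N` attached to a homomorphism of bimodules `Q → Hom_K(M, N)`. -/
noncomputable def bimodTensorUncurry {Q : BimodCat K A} {M N : ModuleCat.{u} A}
    (g : Q →ₗ[EnvAlg K A] (M →ₗ[K] N)) : bimodTensor Q M →ₗ[A] N :=
  (tensorRel K Q M).liftQ
    (TensorProduct.AlgebraTensorModule.lift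
      { toFun := g
        map_add' := map_add g
        map_smul' := fun a q => by
          ext m
          rw [bimod_left_smul_def, map_smul, ← op_one, homEnv_smul_apply, one_smul]
          rfl }) (by
    refine Submodule.span_le.2 ?_
    rintro _ ⟨q, a, m, rfl⟩
    simp only [SetLike.mem_coe, LinearMap.mem_ker, map_sub,
      TensorProduct.AlgebraTensorModule.lift_apply, TensorProduct.lift.tmul]
    change g (bimodRight q a) m - g q (a • m) = 0
    rw [bimodRight, map_smul, homEnv_smul_apply, one_smul, sub_self])

lemma bimodTensor_hom_ext {Q : BimodCat K A} {M N : ModuleCat.{u} A}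
    {f g : bimodTensor Q M →ₗ[A] N}
    (h : ∀ q m, f (bimodTensorMk Q M (q ⊗ₜ m)) = g (bimodTensorMk Q M (q ⊗ₜ m))) : f = g := by
  ext x
  obtain ⟨x, rfl⟩ := bimodTensorMk_surjective Q M x
  induction x with
  | zero => simp
  | tmul q m => exact h q m
  | add x y hx hy => rw [map_add, map_add, map_add, hx, hy]

/-- The adjunction between `- ⊗_A M` and `Hom_K(M, -)`. -/
noncomputable def bimodTensorEquiv (Q : BimodCat K A) (M N : ModuleCat.{u} A) :
    (bimodTensor Q M ⟶ N) ≃ₗ[K] (Q →ₗ[EnvAlg K A] (M →ₗ[K] N)) where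
  toFun f := bimodTensorCurry f.hom
  invFun g := ModuleCat.ofHom (bimodTensorUncurry g)
  left_inv f := by
    ext1
    exact bimodTensor_hom_ext fun q m => rfl
  right_inv g := rfl
  map_add' f g := rfl
  map_smul' k f := rfl

/-- Functoriality of `- ⊗_A M`. -/
noncomputable def bimodTensorMap {Q Q' : BimodCat K A} (f : Q ⟶ Q') (M : ModuleCat.{u} A) :
    bimodTensor Q M ⟶ bimodTensor Q' M :=
  (bimodTensorEquiv Q M _).symm (bimodTensorEquiv Q' M _ (𝟙 _) ∘ₗ f.hom)

lemma bimodTensorMap_mk {Q Q' : BimodCat K A} (f : Q ⟶ Q') (M : ModuleCat.{u} A) (q : Q) (m : M) :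
    (bimodTensorMap f M).hom (bimodTensorMk Q M (q ⊗ₜ m)) = bimodTensorMk Q' M (f.hom q ⊗ₜ m) :=
  rfl

lemma bimodTensorEquiv_comp {Q Q' : BimodCat K A} (f : Q ⟶ Q') (M N : ModuleCat.{u} A)
    (g : bimodTensor Q' M ⟶ N) :
    bimodTensorEquiv Q M N (bimodTensorMap f M ≫ g) = bimodTensorEquiv Q' M N g ∘ₗ f.hom :=
  rfl

end BimodTensor

/-! ### Projectivity of bimodules over the right action. -/

section RightProjective

lemma Module.Projective.compHom {R S : Type*} [Ring R] [Ring S] (φ : R →+* S)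
    (hS : @Module.Projective R _ S _ (Module.compHom S φ)) (Q : Type*) [AddCommGroup Q] [Module S Q]
    [hQ : Module.Projective S Q] : @Module.Projective R _ Q _ (Module.compHom Q φ) := by
  let := Module.compHom S φ
  let := Module.compHom Q φ
  obtain ⟨s, hs⟩ := Module.projective_def'.1 hQ
  classical
  have : Module.Projective R (Q →₀ S) :=
    Module.Projective.of_equiv (finsuppLequivDFinsupp (ι := Q) (M := S) R).symm
  let i : Q →ₗ[R] (Q →₀ S) :=
    { toFun := s
      map_add' := map_add s
      map_smul' := fun r q => map_smul s (φ r) q }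
  let p : (Q →₀ S) →ₗ[R] Q :=
    { toFun := Finsupp.linearCombination S id
      map_add' := map_add _
      map_smul' := fun r q => map_smul (Finsupp.linearCombination S id) (φ r) q }
  exact Module.Projective.of_split i p (LinearMap.ext fun q => LinearMap.congr_fun hs q)

variable {K : Type w} [Field K] {A : Type u} [Ring A] [Algebra K A]

/-- Over a field, `A ⊗ Aᵐᵒᵖ` is a base change of the free K-module `A`, hence free over `Aᵐᵒᵖ`. -/
lemma envAlg_projective_right : @Module.Projective Aᵐᵒᵖ _ (EnvAlg K A) _
    (Module.compHom (EnvAlg K A)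
      (Algebra.TensorProduct.includeRight : Aᵐᵒᵖ →ₐ[K] EnvAlg K A).toRingHom) := by
  let := Module.compHom (EnvAlg K A)
      (Algebra.TensorProduct.includeRight : Aᵐᵒᵖ →ₐ[K] EnvAlg K A).toRingHom
  let e : (Aᵐᵒᵖ ⊗[K] A) ≃ₗ[Aᵐᵒᵖ] EnvAlg K A :=
    { TensorProduct.comm K Aᵐᵒᵖ A with
      map_smul' := fun c x => by
        change TensorProduct.comm K Aᵐᵒᵖ A (c • x) =
          ((1 : A) ⊗ₜ[K] c : EnvAlg K A) * TensorProduct.comm K Aᵐᵒᵖ A x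
        induction x with
        | zero => rw [smul_zero, map_zero]; exact (mul_zero (M₀ := EnvAlg K A) _).symm
        | tmul x y =>
          rw [TensorProduct.smul_tmul', TensorProduct.comm_tmul, TensorProduct.comm_tmul,
            Algebra.TensorProduct.tmul_mul_tmul, one_mul, smul_eq_mul]
        | add x y hx hy =>
          rw [smul_add, map_add, map_add, hx, hy]
          exact (mul_add (R := EnvAlg K A) _ _ _).symm }
  exact Module.Projective.of_equiv e

lemma bimodRight_algebraMap {Q : BimodCat K A} (q : Q) (k : K) :
    bimodRight q (algebraMap K A k) = k • q := by
  rw [bimodRight, Algebra.algebraMap_eq_smul_one, op_smul, TensorProduct.tmul_smul, op_one,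
    ← Algebra.TensorProduct.one_def, smul_assoc, one_smul]

/-- Projective bimodules are projective as right modules. -/
lemma exists_right_lift {Q Q₁ Q₀ : BimodCat K A} [Module.Projective (EnvAlg K A) Q]
    (p : Q₁ ⟶ Q₀) (f : Q →ₗ[K] Q₀) (hf : ∀ q a, f (bimodRight q a) = bimodRight (f q) a)
    (hfp : ∀ q, f q ∈ LinearMap.range p.hom) :
    ∃ t : Q →ₗ[K] Q₁, (∀ q a, t (bimodRight q a) = bimodRight (t q) a) ∧
      ∀ q, p.hom (t q) = f q := by
  let φ : Aᵐᵒᵖ →+* EnvAlg K A :=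
    (Algebra.TensorProduct.includeRight : Aᵐᵒᵖ →ₐ[K] EnvAlg K A).toRingHom
  let := Module.compHom Q φ
  let := Module.compHom Q₁ φ
  let := Module.compHom (LinearMap.range p.hom) φ
  have : Module.Projective Aᵐᵒᵖ Q := Module.Projective.compHom φ envAlg_projective_right Q
  let p' : Q₁ →ₗ[Aᵐᵒᵖ] LinearMap.range p.hom :=
    { toFun := p.hom.rangeRestrict
      map_add' := map_add _
      map_smul' := fun c q => map_smul p.hom.rangeRestrict (φ c) q }
  let f' : Q →ₗ[Aᵐᵒᵖ] LinearMap.range p.hom :=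
    { toFun := fun q => ⟨f q, hfp q⟩
      map_add' := fun _ _ => Subtype.ext (map_add f _ _)
      map_smul' := fun c q => Subtype.ext (hf q c.unop) }
  obtain ⟨t, ht⟩ := Module.projective_lifting_property p' f'
    (fun x => p.hom.surjective_rangeRestrict x)
  have ht' : ∀ q a, t (bimodRight q a) = bimodRight (t q) a := fun q a => map_smul t (op a) q
  refine ⟨{ toFun := t, map_add' := map_add t, map_smul' := fun k q => ?_ }, ht',
    fun q => congrArg Subtype.val (LinearMap.congr_fun ht q)⟩
  rw [← bimodRight_algebraMap, ht', bimodRight_algebraMap]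
  rfl

end RightProjective

/-! ### Projectivity and augmentation of tensor products over A. -/

section TensorExact

variable {K : Type w} [Field K] {A : Type u} [Ring A] [Algebra K A]

attribute [local instance] bimodLeftModule homEnvModule

/-- By adjunction Hom_A(Q ⊗_A M, -) is Hom_{AA}(Q, Hom_K(M, -)), and Hom_K(M, -) is exact because K
is a field. -/
lemma bimodTensor_projective (Q : BimodCat K A) [Module.Projective (EnvAlg K A) Q]
    (M : ModuleCat.{u} A) : Projective (bimodTensor Q M) where
  factors {X Y} f e he := by
    let φ : (M →ₗ[K] X) →ₗ[EnvAlg K A] (M →ₗ[K] Y) :=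
      { toFun := fun g => e.hom.restrictScalars K ∘ₗ g
        map_add' := fun _ _ => by ext; simp
        map_smul' := fun r g => by
          ext m
          induction r using envAlg_induction with
          | zero =>
            have h₁ : (0 : EnvAlg K A) • g = 0 := zero_smul (EnvAlg K A) g
            have h₂ : ∀ g : M →ₗ[K] Y, (0 : EnvAlg K A) • g = 0 :=
              fun g => zero_smul (EnvAlg K A) g
            rw [h₁, RingHom.id_apply, h₂]
            simp
          | tmul b c =>
            rw [RingHom.id_apply, homEnv_smul_apply, LinearMap.comp_apply, homEnv_smul_apply]
            exact map_smul e.hom b _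
          | add x y hx hy =>
            simp only [add_smul, LinearMap.comp_add, RingHom.id_apply,
              LinearMap.add_apply] at hx hy ⊢
            rw [hx, hy] }
    have hφ : Function.Surjective φ := fun g => by
      obtain ⟨s, hs⟩ := (e.hom.restrictScalars K).exists_rightInverse_of_surjective
        (LinearMap.range_eq_top.2 ((ModuleCat.epi_iff_surjective e).1 he))
      exact ⟨s ∘ₗ g, LinearMap.ext fun m => LinearMap.congr_fun hs (g m)⟩
    obtain ⟨g, hg⟩ := Module.projective_lifting_property φ (bimodTensorEquiv Q M Y f) hφ
    refine ⟨(bimodTensorEquiv Q M X).symm g, ?_⟩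
    ext1
    refine bimodTensor_hom_ext fun q m => ?_
    exact LinearMap.congr_fun (LinearMap.congr_fun hg q) m

/-- This lets a contraction that is only right linear act on Q ⊗_A M. The relations form a left
A-span, but its generators are stable under left multiplication since the two actions commute. -/
lemma rTensor_mem_tensorRel {Q Q' : BimodCat K A} {M : ModuleCat.{u} A} (s : Q →ₗ[K] Q')
    (hs : ∀ q a, s (bimodRight q a) = bimodRight (s q) a) {x : Q ⊗[K] M}
    (hx : x ∈ tensorRel K Q M) : s.rTensor M x ∈ tensorRel K Q' M := by
  -- As s is not left linear, the induction over the span must carry all left multiples of x.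
  suffices h : ∀ a : A, s.rTensor M (a • x) ∈ tensorRel K Q' M by simpa using h 1
  induction hx using Submodule.span_induction with
  | mem x hx =>
    obtain ⟨q, c, m, rfl⟩ := hx
    intro a
    refine Submodule.subset_span ⟨s (a • q), c, m, ?_⟩
    rw [smul_sub, TensorProduct.smul_tmul', TensorProduct.smul_tmul', map_sub,
      LinearMap.rTensor_tmul, LinearMap.rTensor_tmul, ← hs, bimodRight_left_smul]
  | zero => intro a; simp
  | add x y _ _ hx hy => intro a; rw [smul_add, map_add]; exact add_mem (hx a) (hy a)
  | smul b x _ hx => intro a; rw [smul_smul]; exact hx _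

lemma bimodTensorMap_mk' {Q Q' : BimodCat K A} (f : Q ⟶ Q') (M : ModuleCat.{u} A)
    (x : Q ⊗[K] M) :
    (bimodTensorMap f M).hom (bimodTensorMk Q M x) =
      bimodTensorMk Q' M ((f.hom.restrictScalars K).rTensor M x) := by
  induction x with
  | zero => simp
  | tmul q m => rfl
  | add x y hx hy => simp only [map_add, hx, hy]

lemma regularBimod_smul (b c : A) (x : regularBimod K A) :
    (b ⊗ₜ[K] op c : EnvAlg K A) • x = (b * ((show A from x) * c) : A) := by
  let : Module (EnvAlg K A) A := TensorProduct.Algebra.module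
  exact TensorProduct.Algebra.smul_def b (op c) (show A from x)

/-- The action of `A` on `M` as a homomorphism of bimodules. -/
noncomputable def regularToEnd (M : ModuleCat.{u} A) :
    regularBimod K A →ₗ[EnvAlg K A] (M →ₗ[K] M) where
  toFun a := Algebra.lsmul K K M (show A from a)
  map_add' a b := map_add (Algebra.lsmul K K M) (show A from a) (show A from b)
  map_smul' e a := by
    ext m
    induction e using envAlg_induction with
    | zero =>
      have h₁ : (0 : EnvAlg K A) • a = 0 := zero_smul (EnvAlg K A) a
      have h₂ : ∀ g : M →ₗ[K] M, (0 : EnvAlg K A) • g = 0 := fun g => zero_smul (EnvAlg K A) g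
      rw [h₁, RingHom.id_apply, h₂]
      exact zero_smul A m
    | tmul b c =>
      rw [RingHom.id_apply, homEnv_smul_apply, regularBimod_smul]
      change (b * ((show A from a) * c)) • m = b • (show A from a) • c • m
      rw [mul_smul, mul_smul]
    | add x y hx hy =>
      rw [RingHom.id_apply] at hx hy ⊢
      rw [add_smul, add_smul, LinearMap.add_apply, ← hx, ← hy]
      exact add_smul (show A from x • a) (show A from y • a) m

/-- The augmentation `Q ⊗_A M → M`. -/
noncomputable def bimodAug {Q : BimodCat K A} (ε : Q ⟶ regularBimod K A) (M : ModuleCat.{u} A) :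
    bimodTensor Q M ⟶ M :=
  (bimodTensorEquiv Q M M).symm (regularToEnd M ∘ₗ ε.hom)

lemma bimodAug_mk {Q : BimodCat K A} (ε : Q ⟶ regularBimod K A) (M : ModuleCat.{u} A) (q : Q)
    (m : M) : (bimodAug ε M).hom (bimodTensorMk Q M (q ⊗ₜ m)) = (show A from ε.hom q) • m := rfl

end TensorExact

/-! ### Finite-dimensional `Ext` spaces and the Euler form -/

section LinearAlgebra

variable {K V₁ V₂ V₃ : Type*} [Field K] [AddCommGroup V₁] [Module K V₁] [AddCommGroup V₂]
  [Module K V₂] [AddCommGroup V₃] [Module K V₃]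

lemma FiniteDimensional.of_exact {f : V₁ →ₗ[K] V₂} {g : V₂ →ₗ[K] V₃} (h : Function.Exact f g)
    [FiniteDimensional K V₁] [FiniteDimensional K V₃] : FiniteDimensional K V₂ := by
  have h1 : FiniteDimensional K (LinearMap.ker g) := by
    rw [LinearMap.exact_iff.1 h]; infer_instance
  have h2 : FiniteDimensional K (V₂ ⧸ LinearMap.ker g) :=
    LinearEquiv.finiteDimensional g.quotKerEquivRange.symm
  exact Module.Finite.of_submodule_quotient (LinearMap.ker g)

lemma finrank_eq_of_exact {f : V₁ →ₗ[K] V₂} {g : V₂ →ₗ[K] V₃} (h : Function.Exact f g)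
    [FiniteDimensional K V₂] : Module.finrank K V₂ =
      Module.finrank K (LinearMap.range f) + Module.finrank K (LinearMap.range g) := by
  rw [← LinearMap.exact_iff.1 h, add_comm, LinearMap.finrank_range_add_finrank_ker]

end LinearAlgebra

namespace CategoryTheory

open Abelian

variable (K : Type w) [Field K] {C : Type*} [Category* C] [Abelian C] [Linear K C] [HasExt.{u} C]

/-- All spaces `Extⁿ(X, Y)` are finite-dimensional. -/
def ExtFinite (X Y : C) : Prop := ∀ n, FiniteDimensional K (Ext.{u} X Y n)

/-- The Euler form, for objects of projective dimension at most two. -/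
noncomputable def eulerForm (X Y : C) : ℤ :=
  Module.finrank K (Ext.{u} X Y 0) - Module.finrank K (Ext.{u} X Y 1) +
    Module.finrank K (Ext.{u} X Y 2)

variable {K} {S : ShortComplex C} (hS : S.ShortExact) (Y : C)

include hS in
lemma exact_precomp₂ (n : ℕ) : Function.Exact
    ((Ext.mk₀ S.g).precompOfLinear K Y (zero_add n))
    ((Ext.mk₀ S.f).precompOfLinear K Y (zero_add n)) := fun x => by
  constructor
  · intro h
    exact Ext.contravariant_sequence_exact₂ hS Y x h
  · rintro ⟨y, rfl⟩
    simp

lemma exact_precomp₁ (n m : ℕ) (h : 1 + n = m) : Function.Exact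
    ((Ext.mk₀ S.f).precompOfLinear K Y (zero_add n))
    (hS.extClass.precompOfLinear K Y h) := fun x => by
  constructor
  · intro h'
    exact Ext.contravariant_sequence_exact₁ hS Y x h h'
  · rintro ⟨y, rfl⟩
    simp

lemma exact_precomp₃ (n m : ℕ) (h : 1 + n = m) : Function.Exact
    (hS.extClass.precompOfLinear K Y h)
    ((Ext.mk₀ S.g).precompOfLinear K Y (zero_add m)) := fun x => by
  constructor
  · intro h'
    exact Ext.contravariant_sequence_exact₃ hS Y x h' h
  · rintro ⟨y, rfl⟩
    simp

include hS in
lemma injective_precomp : Function.Injective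
    ((Ext.mk₀ S.g).precompOfLinear K Y (zero_add 0)) :=
  have := hS.epi_g
  Ext.precomp_mk₀_injective_of_epi Y S.g

variable {Y}

include hS in
lemma ExtFinite.of_shortExact₂ (h₁ : ExtFinite.{w, u} K S.X₁ Y) (h₃ : ExtFinite.{w, u} K S.X₃ Y) :
    ExtFinite.{w, u} K S.X₂ Y := fun n =>
  have := h₁ n
  have := h₃ n
  FiniteDimensional.of_exact (exact_precomp₂ (K := K) hS Y n)

include hS in
lemma ExtFinite.of_shortExact₁ (h₂ : ExtFinite.{w, u} K S.X₂ Y) (h₃ : ExtFinite.{w, u} K S.X₃ Y) :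
    ExtFinite.{w, u} K S.X₁ Y := fun n =>
  have := h₂ n
  have := h₃ (1 + n)
  FiniteDimensional.of_exact (exact_precomp₁ (K := K) hS Y n (1 + n) rfl)

include hS in
lemma ExtFinite.of_shortExact₃ (h₁ : ExtFinite.{w, u} K S.X₁ Y) (h₂ : ExtFinite.{w, u} K S.X₂ Y) :
    ExtFinite.{w, u} K S.X₃ Y := fun n => by
  cases n with
  | zero =>
    have := h₂ 0
    exact FiniteDimensional.of_injective _ (injective_precomp (K := K) hS Y)
  | succ n =>
    have := h₁ n
    have := h₂ (n + 1)
    exact FiniteDimensional.of_exact (exact_precomp₃ (K := K) hS Y n (n + 1) (add_comm _ _))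

lemma ExtFinite.of_projective {P : C} [Projective P] (h : FiniteDimensional K (P ⟶ Y)) :
    ExtFinite.{w, u} K P Y := fun n => by
  cases n with
  | zero => exact LinearEquiv.finiteDimensional (Ext.linearEquiv₀ (R := K)).symm
  | succ n =>
    have : Subsingleton (Ext.{u} P Y (n + 1)) := ⟨fun a b => by
      rw [a.eq_zero_of_projective, b.eq_zero_of_projective]⟩
    infer_instance

lemma eulerForm_of_projective {P : C} [Projective P] :
    eulerForm.{w, u} K P Y = Module.finrank K (P ⟶ Y) := by
  have h : ∀ n, Module.finrank K (Ext.{u} P Y (n + 1)) = 0 := fun n => by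
    have : Subsingleton (Ext.{u} P Y (n + 1)) := ⟨fun a b => by
      rw [a.eq_zero_of_projective, b.eq_zero_of_projective]⟩
    exact Module.finrank_zero_of_subsingleton
  rw [eulerForm, h 0, h 1, (Ext.linearEquiv₀ (R := K)).finrank_eq]
  simp

include hS in
/-- The Euler form is additive on short exact sequences. -/
lemma eulerForm_shortExact (h₁ : ExtFinite.{w, u} K S.X₁ Y) (h₃ : ExtFinite.{w, u} K S.X₃ Y)
    [HasProjectiveDimensionLT S.X₃ 3] :
    eulerForm.{w, u} K S.X₂ Y = eulerForm.{w, u} K S.X₁ Y + eulerForm.{w, u} K S.X₃ Y := by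
  have h₂ := ExtFinite.of_shortExact₂ hS h₁ h₃
  have := h₁ 0
  have := h₁ 1
  have := h₁ 2
  have := h₂ 0
  have := h₂ 1
  have := h₂ 2
  have := h₃ 0
  have := h₃ 1
  have := h₃ 2
  have e0 := LinearMap.finrank_range_of_inj (injective_precomp (K := K) hS Y)
  have e1 := finrank_eq_of_exact (exact_precomp₂ (K := K) hS Y 0)
  have e2 := finrank_eq_of_exact (exact_precomp₁ (K := K) hS Y 0 1 rfl)
  have e3 := finrank_eq_of_exact (exact_precomp₃ (K := K) hS Y 0 1 rfl)
  have e4 := finrank_eq_of_exact (exact_precomp₂ (K := K) hS Y 1)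
  have e5 := finrank_eq_of_exact (exact_precomp₁ (K := K) hS Y 1 2 rfl)
  have e6 := finrank_eq_of_exact (exact_precomp₃ (K := K) hS Y 1 2 rfl)
  have e7 := finrank_eq_of_exact (exact_precomp₂ (K := K) hS Y 2)
  have e8 := finrank_eq_of_exact (exact_precomp₁ (K := K) hS Y 2 3 rfl)
  have : Subsingleton (Ext.{u} S.X₃ Y 3) := HasProjectiveDimensionLT.subsingleton _ 3 3 le_rfl _
  have e9 : Module.finrank K (LinearMap.range (hS.extClass.precompOfLinear K Y
    (show 1 + 2 = 3 from rfl))) = 0 := Module.finrank_zero_of_subsingleton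
  simp only [eulerForm]
  omega

/-- `Ext²` as a cokernel, for an object with a projective resolution of length two. -/
lemma surjective_extClass_of_projective [Projective S.X₂] (n m : ℕ) (h : 1 + n = m) :
    Function.Surjective (hS.extClass.precompOfLinear K Y h) := fun x =>
  Ext.contravariant_sequence_exact₃ hS Y x (by
    obtain rfl : m = n + 1 := by omega
    exact Ext.eq_zero_of_projective _) h

end CategoryTheory

lemma ModuleCat.shortExact_mk {R : Type*} [Ring R] {X Y Z : ModuleCat.{u} R} (f : X ⟶ Y)
    (g : Y ⟶ Z) (hi : Function.Injective f.hom) (he : Function.Exact f.hom g.hom)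
    (hs : Function.Surjective g.hom) :
    ∃ h : f ≫ g = 0, (ShortComplex.mk f g h).ShortExact := by
  have h : f ≫ g = 0 := by
    ext x
    exact he.apply_apply_eq_zero x
  refine ⟨h, ?_⟩
  have := (ModuleCat.mono_iff_injective f).2 hi
  have := (ModuleCat.epi_iff_surjective g).2 hs
  exact { exact := (ShortComplex.ShortExact.moduleCat_exact_iff_function_exact _).2 he }

/-! ### Resolutions of modules obtained by tensoring a bimodule resolution. -/

namespace IsBimodResolution

variable {K : Type w} [Field K] {A : Type u} [Ring A] [Algebra K A]

attribute [local instance] bimodLeftModule homEnvModule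

variable {P₂ P₁ P₀ : BimodCat K A} {d₂ : P₂ ⟶ P₁} {d₁ : P₁ ⟶ P₀} {ε : P₀ ⟶ regularBimod K A}
  (h : IsBimodResolution d₂ d₁ ε)

include h

/-- A resolution of the bimodule `A` is contractible as a complex of right modules. -/
lemma exists_contraction : ∃ (s : P₀) (t : P₀ →ₗ[K] P₁) (r : P₁ →ₗ[K] P₂),
    (∀ q a, t (bimodRight q a) = bimodRight (t q) a) ∧
    (∀ q a, r (bimodRight q a) = bimodRight (r q) a) ∧
    (∀ q, d₁.hom (t q) + bimodRight s (show A from ε.hom q) = q) ∧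
    (∀ q, d₂.hom (r q) + t (d₁.hom q) = q) ∧ ∀ q, r (d₂.hom q) = q := by
  have := h.projective₀
  obtain ⟨s, hs⟩ := h.surjective (show regularBimod K A from (1 : A))
  have hlin : ∀ (Q : BimodCat K A) (a b : A) (q : Q), bimodRight q (a + b) =
      bimodRight q a + bimodRight q b := fun Q a b q => by
    rw [bimodRight, MulOpposite.op_add, TensorProduct.tmul_add, add_smul]; rfl
  have hmul : ∀ (Q : BimodCat K A) (a b : A) (q : Q), bimodRight q (a * b) =
      bimodRight (bimodRight q a) b := fun Q a b q => by
    rw [bimodRight, bimodRight, bimodRight, smul_smul, Algebra.TensorProduct.tmul_mul_tmul,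
      one_mul, op_mul]
  have hreg : ∀ (x : regularBimod K A) (a : A), bimodRight x a = ((show A from x) * a : A) :=
    fun x a => (regularBimod_smul 1 a x).trans (one_mul (M := A) _)
  have hε : ∀ q a, ε.hom (bimodRight q a) = bimodRight (ε.hom q) a := fun q a =>
    map_smul ε.hom _ q
  have hadd : ∀ (Q : BimodCat K A) (a : A) (q q' : Q), bimodRight (q + q') a =
      bimodRight q a + bimodRight q' a := fun Q a q q' => smul_add _ q q'
  have hksmul : ∀ (Q : BimodCat K A) (a : A) (k : K) (q : Q), bimodRight q (k • a) =
      k • bimodRight q a := fun Q a k q => by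
    rw [bimodRight, op_smul, TensorProduct.tmul_smul, smul_assoc]; rfl
  -- Since ε(s) = 1, right multiples of s split ε; subtracting this splitting projects onto the
  -- kernel of ε, which is the image of d₁.
  let f : P₀ →ₗ[K] P₀ :=
    { toFun := fun q => q - bimodRight s (show A from ε.hom q)
      map_add' := fun q q' => by
        have : (show A from ε.hom (q + q')) = (show A from ε.hom q) + (show A from ε.hom q') :=
          map_add ε.hom q q'
        rw [this, hlin]; abel
      map_smul' := fun k q => by
        have : (show A from ε.hom (k • q)) = k • (show A from ε.hom q) := by
          have h1 : ε.hom (k • q) = ε.hom (bimodRight q (algebraMap K A k)) := by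
            rw [bimodRight_algebraMap]
          rw [h1, hε, hreg, ← Algebra.commutes, Algebra.smul_def]
        rw [this, hksmul, RingHom.id_apply, smul_sub] }
  have hf : ∀ q a, f (bimodRight q a) = bimodRight (f q) a := fun q a => by
    have h1 : (show A from ε.hom (bimodRight q a)) = (show A from ε.hom q) * a := by
      rw [hε, hreg]
    change bimodRight q a - bimodRight s (show A from ε.hom (bimodRight q a)) =
      bimodRight (q - bimodRight s (show A from ε.hom q)) a
    rw [h1, hmul, sub_eq_add_neg, sub_eq_add_neg, hadd]
    congr 1
    exact (smul_neg _ _).symm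
  have hfr : ∀ q, f q ∈ LinearMap.range d₁.hom := fun q => by
    refine (h.exact₀ _).1 ?_
    change ε.hom (q - bimodRight s (show A from ε.hom q)) = 0
    rw [map_sub, hε, hs, hreg]
    exact sub_eq_zero.2 (one_mul (show A from ε.hom q)).symm
  obtain ⟨t, ht, htf⟩ := exists_right_lift d₁ f hf hfr
  have hex : ∀ q, q - t (d₁.hom q) ∈ LinearMap.range d₂.hom := fun q => by
    refine (h.exact₁ _).1 ?_
    rw [map_sub, htf]
    change d₁.hom q - (d₁.hom q - bimodRight s (show A from ε.hom (d₁.hom q))) = 0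
    -- Zero is written as a scalar multiple so that `hksmul` shows that the right multiple of s by
    -- it vanishes.
    have h0 : (show A from ε.hom (d₁.hom q)) = (0 : K) • (0 : A) :=
      (h.exact₀.apply_apply_eq_zero q).trans (smul_zero (A := A) (0 : K)).symm
    rw [sub_sub_cancel, h0, hksmul, zero_smul]
  -- The chosen preimage is unique because d₂ is injective, which makes r additive and right linear.
  choose r hr using hex
  have hrr : ∀ q a, r (bimodRight q a) = bimodRight (r q) a := fun q a => h.injective (by
    have h1 : d₂.hom (bimodRight (r q) a) = bimodRight (d₂.hom (r q)) a := map_smul d₂.hom _ _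
    have h2 : d₁.hom (bimodRight q a) = bimodRight (d₁.hom q) a := map_smul d₁.hom _ _
    rw [hr, h1, hr, h2, ht]
    exact (smul_sub _ _ _).symm)
  have hradd : ∀ q q', r (q + q') = r q + r q' := fun q q' => h.injective (by
    rw [map_add, hr, hr, hr, map_add, map_add]; abel)
  refine ⟨s, t, { toFun := r, map_add' := hradd, map_smul' := fun k q => ?_ }, ht, hrr,
    fun q => ?_, fun q => ?_, fun q => ?_⟩
  · rw [← bimodRight_algebraMap, hrr, bimodRight_algebraMap]; rfl
  · rw [htf]
    exact sub_add_cancel _ _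
  · exact (congrArg (· + t (d₁.hom q)) (hr q)).trans (sub_add_cancel _ _)
  · refine h.injective ((hr _).trans ?_)
    rw [h.exact₁.apply_apply_eq_zero, map_zero, sub_zero]

/-- The right-linear contraction survives tensoring with `M`. Flatness is not needed. -/
lemma tensor_exact (M : ModuleCat.{u} A) :
    Function.Injective (bimodTensorMap d₂ M).hom ∧
    Function.Exact (bimodTensorMap d₂ M).hom (bimodTensorMap d₁ M).hom ∧
    Function.Exact (bimodTensorMap d₁ M).hom (bimodAug ε M).hom ∧
    Function.Surjective (bimodAug ε M).hom := by
  obtain ⟨s, t, r, ht, hr, h₀, h₁, h₂⟩ := h.exists_contraction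
  have e₂ : ∀ x : P₂ ⊗[K] M, r.rTensor M ((d₂.hom.restrictScalars K).rTensor M x) = x := by
    intro x
    rw [← LinearMap.comp_apply, ← LinearMap.rTensor_comp]
    convert LinearMap.rTensor_id_apply M P₂ x
    ext q
    exact h₂ q
  have e₁ : ∀ x : P₁ ⊗[K] M, (d₂.hom.restrictScalars K).rTensor M (r.rTensor M x) +
      t.rTensor M ((d₁.hom.restrictScalars K).rTensor M x) = x := by
    intro x
    rw [← LinearMap.comp_apply, ← LinearMap.rTensor_comp, ← LinearMap.comp_apply,
      ← LinearMap.rTensor_comp, ← LinearMap.add_apply, ← LinearMap.rTensor_add]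
    convert LinearMap.rTensor_id_apply M P₁ x
    ext q
    exact h₁ q
  -- This identity holds only in P₀ ⊗_A M, where s ε(q) ⊗ m = s ⊗ ε(q) m.
  have e₀ : ∀ x : P₀ ⊗[K] M, bimodTensorMk P₀ M x =
      bimodTensorMk P₀ M ((d₁.hom.restrictScalars K).rTensor M (t.rTensor M x)) +
      bimodTensorMk P₀ M (s ⊗ₜ[K] (bimodAug ε M).hom (bimodTensorMk P₀ M x)) := by
    intro x
    induction x with
    | zero => simp
    | tmul q m =>
      rw [bimodAug_mk, ← bimodTensorMk_right, ← map_add, LinearMap.rTensor_tmul,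
        LinearMap.rTensor_tmul, ← TensorProduct.add_tmul]
      congr 2
      exact (h₀ q).symm
    | add x y hx hy =>
      simp only [map_add, TensorProduct.tmul_add]
      rw [add_add_add_comm, ← hx, ← hy]
  have d₂₁ : ∀ q, d₁.hom (d₂.hom q) = 0 := h.exact₁.apply_apply_eq_zero
  refine ⟨(injective_iff_map_eq_zero _).2 fun x hx => ?_, fun x => ⟨fun hx => ?_, ?_⟩,
    fun x => ⟨fun hx => ?_, ?_⟩, fun m => ?_⟩
  · obtain ⟨x, rfl⟩ := bimodTensorMk_surjective P₂ M x
    rw [bimodTensorMap_mk', bimodTensorMk_eq_zero] at hx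
    rw [bimodTensorMk_eq_zero, ← e₂ x]
    exact rTensor_mem_tensorRel r hr hx
  · obtain ⟨x, rfl⟩ := bimodTensorMk_surjective P₁ M x
    rw [bimodTensorMap_mk', bimodTensorMk_eq_zero] at hx
    refine ⟨bimodTensorMk P₂ M (r.rTensor M x), ?_⟩
    rw [bimodTensorMap_mk']
    conv_rhs => rw [← e₁ x, map_add, bimodTensorMk_eq_zero.2 (rTensor_mem_tensorRel t ht hx),
      add_zero]
  · rintro ⟨x, rfl⟩
    obtain ⟨x, rfl⟩ := bimodTensorMk_surjective P₂ M x
    induction x with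
    | zero => simp
    | tmul q m => rw [bimodTensorMap_mk, bimodTensorMap_mk, d₂₁]; simp
    | add x y hx hy => simp only [map_add, hx, hy, add_zero]
  · obtain ⟨x, rfl⟩ := bimodTensorMk_surjective P₀ M x
    refine ⟨bimodTensorMk P₁ M (t.rTensor M x), ?_⟩
    rw [bimodTensorMap_mk']
    conv_rhs => rw [e₀ x, hx, TensorProduct.tmul_zero, map_zero, add_zero]
  · rintro ⟨x, rfl⟩
    obtain ⟨x, rfl⟩ := bimodTensorMk_surjective P₁ M x
    induction x with
    | zero => simp
    | tmul q m =>
      rw [bimodTensorMap_mk, bimodAug_mk]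
      have : (show A from ε.hom (d₁.hom q)) = (0 : A) := h.exact₀.apply_apply_eq_zero q
      rw [this, zero_smul]
    | add x y hx hy => simp only [map_add, hx, hy, add_zero]
  · obtain ⟨q, hq⟩ := h.surjective (show regularBimod K A from (1 : A))
    refine ⟨bimodTensorMk P₀ M (q ⊗ₜ m), ?_⟩
    rw [bimodAug_mk, hq]
    exact one_smul A m

/-- The projective resolution `0 → P₂ ⊗_A M → P₁ ⊗_A M → P₀ ⊗_A M → M → 0`, as two short exact
sequences. -/
lemma exists_shortExact (M : ModuleCat.{u} A) :
    ∃ (Ω : ModuleCat.{u} A) (i : Ω ⟶ bimodTensor P₀ M) (p : bimodTensor P₁ M ⟶ Ω)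
      (w₀ : i ≫ bimodAug ε M = 0) (w₁ : bimodTensorMap d₂ M ≫ p = 0),
      (ShortComplex.mk i (bimodAug ε M) w₀).ShortExact ∧
      (ShortComplex.mk (bimodTensorMap d₂ M) p w₁).ShortExact := by
  obtain ⟨h₂, h₁, h₀, h₃⟩ := h.tensor_exact M
  let Ω : ModuleCat.{u} A := ModuleCat.of A (LinearMap.ker (bimodAug ε M).hom)
  let i : Ω ⟶ bimodTensor P₀ M := ModuleCat.ofHom (LinearMap.ker (bimodAug ε M).hom).subtype
  let p : bimodTensor P₁ M ⟶ Ω := ModuleCat.ofHom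
    ((bimodTensorMap d₁ M).hom.codRestrict _ fun x => h₀.apply_apply_eq_zero x)
  obtain ⟨w₀, s₀⟩ := ModuleCat.shortExact_mk i (bimodAug ε M) Subtype.val_injective
    (fun x => ⟨fun hx => ⟨⟨x, hx⟩, rfl⟩, by rintro ⟨y, rfl⟩; exact y.2⟩) h₃
  obtain ⟨w₁, s₁⟩ := ModuleCat.shortExact_mk (bimodTensorMap d₂ M) p h₂
    (fun x => by rw [← h₁ x]; exact Subtype.ext_iff)
    (fun x => by
      obtain ⟨y, hy⟩ := (h₀ x.1).1 x.2
      exact ⟨y, Subtype.ext hy⟩)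
  exact ⟨Ω, i, p, w₀, w₁, s₀, s₁⟩

lemma hasProjectiveDimensionLT (M : ModuleCat.{u} A) : HasProjectiveDimensionLT M 3 := by
  obtain ⟨Ω, i, p, w₀, w₁, s₀, s₁⟩ := h.exists_shortExact M
  have := h.projective₀
  have := h.projective₁
  have := h.projective₂
  have := bimodTensor_projective P₀ M
  have := bimodTensor_projective P₁ M
  have := bimodTensor_projective P₂ M
  have h1 : HasProjectiveDimensionLT Ω 2 :=
    s₁.hasProjectiveDimensionLT_X₃ 1 
      (inferInstanceAs (HasProjectiveDimensionLT (bimodTensor P₂ M) 1))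
      (inferInstanceAs (HasProjectiveDimensionLT (bimodTensor P₁ M) (1 + 1)))
  exact s₀.hasProjectiveDimensionLT_X₃ 2 h1
      (inferInstanceAs (HasProjectiveDimensionLT (bimodTensor P₀ M) (1 + 2)))

/-- Dimension shifting: the connecting map from the first syzygy to Ext² is bijective, and Ext¹ of
the syzygy is the cokernel of Hom from P₁ into Hom from P₂. -/
lemma exists_ext_two (M N : ModuleCat.{u} A) :
    ∃ δ : (P₂ →ₗ[EnvAlg K A] (M →ₗ[K] N)) →ₗ[K] Abelian.Ext.{u} M N 2, Function.Surjective δ ∧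
      ∀ g, δ g = 0 ↔ ∃ g₁ : P₁ →ₗ[EnvAlg K A] (M →ₗ[K] N), g₁ ∘ₗ d₂.hom = g := by
  obtain ⟨Ω, i, p, w₀, w₁, s₀, s₁⟩ := h.exists_shortExact M
  have := h.projective₀
  have := h.projective₁
  have : Projective (ShortComplex.mk i (bimodAug ε M) w₀).X₂ := bimodTensor_projective P₀ M
  have : Projective (ShortComplex.mk (bimodTensorMap d₂ M) p w₁).X₂ := bimodTensor_projective P₁ M
  let e := ((Abelian.Ext.linearEquiv₀ (R := K)).trans (bimodTensorEquiv P₂ M N))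
  let δ₁ : Abelian.Ext.{u} (bimodTensor P₂ M) N 0 →ₗ[K] Abelian.Ext.{u} Ω N 1 :=
    s₁.extClass.precompOfLinear K N (show 1 + 0 = 1 from rfl)
  let δ₂ : Abelian.Ext.{u} Ω N 1 →ₗ[K] Abelian.Ext.{u} M N 2 :=
    s₀.extClass.precompOfLinear K N (show 1 + 1 = 2 from rfl)
  have hδ₁ : Function.Surjective δ₁ := surjective_extClass_of_projective s₁ 0 1 rfl
  have hδ₂ : Function.Surjective δ₂ := surjective_extClass_of_projective s₀ 1 2 rfl
  have hδ₂' : Function.Injective δ₂ := (injective_iff_map_eq_zero _).2 fun x hx => by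
    obtain ⟨y, rfl⟩ := (exact_precomp₁ (K := K) s₀ N 1 2 rfl x).1 hx
    rw [Abelian.Ext.eq_zero_of_projective y, map_zero]
  refine ⟨δ₂ ∘ₗ δ₁ ∘ₗ e.symm.toLinearMap, hδ₂.comp (hδ₁.comp e.symm.surjective), fun g => ?_⟩
  rw [LinearMap.comp_apply, map_eq_zero_iff δ₂ hδ₂']
  refine (exact_precomp₁ (K := K) s₁ N 0 1 rfl (e.symm g)).trans ⟨?_, ?_⟩
  · rintro ⟨y, hy⟩
    obtain ⟨y, rfl⟩ := (Abelian.Ext.linearEquiv₀ (R := K)).symm.surjective y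
    refine ⟨bimodTensorEquiv P₁ M N y, ?_⟩
    rw [← bimodTensorEquiv_comp]
    apply e.symm.injective
    rw [← hy]
    simp [e]
  · rintro ⟨g₁, rfl⟩
    obtain ⟨y, rfl⟩ := (bimodTensorEquiv P₁ M N).surjective g₁
    refine ⟨(Abelian.Ext.linearEquiv₀ (R := K)).symm y, ?_⟩
    rw [← bimodTensorEquiv_comp]
    simp [e]

/-- Apply additivity of the Euler form to the two short exact sequences. Finiteness is assumed of
the Hom spaces themselves, so that the lemma also applies to the dual resolution, whose Hom spaces
are duals of known ones. -/
lemma extFinite (M N : ModuleCat.{u} A)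
    (h₀ : FiniteDimensional K (P₀ →ₗ[EnvAlg K A] (M →ₗ[K] N)))
    (h₁ : FiniteDimensional K (P₁ →ₗ[EnvAlg K A] (M →ₗ[K] N)))
    (h₂ : FiniteDimensional K (P₂ →ₗ[EnvAlg K A] (M →ₗ[K] N))) :
    ExtFinite.{w, u} K M N ∧ eulerForm.{w, u} K M N =
      Module.finrank K (P₀ →ₗ[EnvAlg K A] (M →ₗ[K] N)) -
      Module.finrank K (P₁ →ₗ[EnvAlg K A] (M →ₗ[K] N)) +
      Module.finrank K (P₂ →ₗ[EnvAlg K A] (M →ₗ[K] N)) := by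
  obtain ⟨Ω, i, p, w₀, w₁, s₀, s₁⟩ := h.exists_shortExact M
  have := h.projective₀
  have := h.projective₁
  have := h.projective₂
  have := bimodTensor_projective P₀ M
  have := bimodTensor_projective P₁ M
  have := bimodTensor_projective P₂ M
  have f₀ : ExtFinite.{w, u} K (bimodTensor P₀ M) N :=
    .of_projective (LinearEquiv.finiteDimensional (bimodTensorEquiv P₀ M N).symm)
  have f₁ : ExtFinite.{w, u} K (bimodTensor P₁ M) N :=
    .of_projective (LinearEquiv.finiteDimensional (bimodTensorEquiv P₁ M N).symm)
  have f₂ : ExtFinite.{w, u} K (bimodTensor P₂ M) N :=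
    .of_projective (LinearEquiv.finiteDimensional (bimodTensorEquiv P₂ M N).symm)
  have fΩ : ExtFinite.{w, u} K Ω N := .of_shortExact₃ s₁ f₂ f₁
  have fM : ExtFinite.{w, u} K M N := .of_shortExact₃ s₀ fΩ f₀
  have : HasProjectiveDimensionLT (ShortComplex.mk i (bimodAug ε M) w₀).X₃ 3 :=
    h.hasProjectiveDimensionLT M
  have : HasProjectiveDimensionLT (ShortComplex.mk (bimodTensorMap d₂ M) p w₁).X₃ 3 :=
    h.hasProjectiveDimensionLT Ω
  have e₀ := eulerForm_shortExact (K := K) s₀ fΩ fM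
  have e₁ := eulerForm_shortExact (K := K) s₁ f₂ fΩ
  refine ⟨fM, ?_⟩
  have c₀ := eulerForm_of_projective.{w, u} (K := K) (P := bimodTensor P₀ M) (Y := N)
  have c₁ := eulerForm_of_projective.{w, u} (K := K) (P := bimodTensor P₁ M) (Y := N)
  have c₂ := eulerForm_of_projective.{w, u} (K := K) (P := bimodTensor P₂ M) (Y := N)
  rw [(bimodTensorEquiv _ M N).finrank_eq] at c₀ c₁ c₂
  dsimp only at e₀ e₁
  omega

end IsBimodResolution

/-! ### Duality -/

section TraceDual

variable {K V U : Type*} [Field K] [AddCommGroup V] [Module K V] [AddCommGroup U] [Module K U]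

lemma comp_smulRight_eq (g : U →ₗ[K] V) (ξ : V →ₗ[K] K) (u : U) :
    g ∘ₗ ξ.smulRight u = ξ.smulRight (g u) := by
  ext; simp

variable [FiniteDimensional K V]

/-- The trace pairing `(g, f) ↦ tr(g f)` identifies `Hom(U, V)` with the dual of `Hom(V, U)`. -/
noncomputable def traceDual : (U →ₗ[K] V) ≃ₗ[K] Module.Dual K (V →ₗ[K] U) := by
  refine LinearEquiv.ofBijective (LinearMap.mk₂ K (fun g f => LinearMap.trace K V (g ∘ₗ f))
    (by intros; simp [LinearMap.add_comp]) (by intros; simp [LinearMap.smul_comp])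
    (by intros; simp [LinearMap.comp_add]) (by intros; simp [LinearMap.comp_smul]))
    ⟨(injective_iff_map_eq_zero _).2 fun g hg => ?_, fun η => ?_⟩
  · ext u
    rw [LinearMap.zero_apply, ← Module.forall_dual_apply_eq_zero_iff K]
    intro ξ
    have h : LinearMap.trace K V (g ∘ₗ ξ.smulRight u) = 0 := LinearMap.congr_fun hg (ξ.smulRight u)
    rwa [comp_smulRight_eq, LinearMap.trace_smulRight] at h
  · let b := Module.finBasis K V
    -- The preimage of η has as coordinates the values of η on the rank-one maps sending `b i` to u.
    -- Only V needs a finite basis.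
    let g : U →ₗ[K] V := ∑ i, (LinearMap.toSpanSingleton K V (b i)) ∘ₗ η ∘ₗ
      (LinearMap.smulRightₗ (b.coord i))
    have hg : ∀ u, g u = ∑ i, η ((b.coord i).smulRight u) • b i := fun u => by
      simp [g]
    refine ⟨g, LinearMap.ext fun f => ?_⟩
    have hf : f = ∑ i, (b.coord i).smulRight (f (b i)) := b.ext fun j => by
      simp [Finsupp.single_apply, LinearMap.sum_apply]
    rw [LinearMap.mk₂_apply]
    have hgf : g ∘ₗ f = ∑ i, g ∘ₗ (b.coord i).smulRight (f (b i)) := by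
      conv_lhs => rw [hf]
      ext v
      simp [LinearMap.sum_apply]
    conv_rhs => rw [hf, map_sum]
    rw [hgf, map_sum]
    refine Finset.sum_congr rfl fun i _ => ?_
    rw [comp_smulRight_eq, LinearMap.trace_smulRight, hg, map_sum]
    simp [Finsupp.single_apply]

lemma traceDual_apply (g : U →ₗ[K] V) (f : V →ₗ[K] U) :
    traceDual g f = LinearMap.trace K V (g ∘ₗ f) := rfl

end TraceDual

/-! ### Trace duality for bimodule homomorphisms. -/

section HomDual

variable {K : Type w} [Field K] {A : Type u} [Ring A] [Algebra K A]

attribute [local instance] homEnvModule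

variable {M : ModuleCat.{u} A} [FiniteDimensional K M] (N : ModuleCat.{u} A)

variable {N} in
-- Cyclicity of the trace moves the action from one factor to the other and exchanges left and
-- right.
lemma traceDual_smul (e : EnvAlg K A) (g : N →ₗ[K] M) (f : M →ₗ[K] N) :
    traceDual (e • g) f = traceDual g ((envSwap K A e).unop • f) := by
  induction e using envAlg_induction with
  | zero =>
    have h₁ : (0 : EnvAlg K A) • g = 0 := zero_smul (EnvAlg K A) g
    have h₂ : (envSwap K A 0).unop = 0 := by rw [map_zero]; rfl
    have h₃ : (0 : EnvAlg K A) • f = 0 := zero_smul (EnvAlg K A) f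
    rw [h₁, h₂, h₃]
    simp
  | tmul b c =>
    rw [envSwap_tmul, unop_op, traceDual_apply, traceDual_apply]
    have h₁ : ((b ⊗ₜ[K] op c : EnvAlg K A) • g) ∘ₗ f =
        (Algebra.lsmul K K M b) * (g ∘ₗ (Algebra.lsmul K K N c) ∘ₗ f) := by
      ext m
      rw [LinearMap.comp_apply, homEnv_smul_apply]
      rfl
    have h₂ : g ∘ₗ ((c ⊗ₜ[K] op b : EnvAlg K A) • f) =
        (g ∘ₗ (Algebra.lsmul K K N c) ∘ₗ f) * (Algebra.lsmul K K M b) := by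
      ext m
      rw [LinearMap.comp_apply, homEnv_smul_apply]
      rfl
    rw [h₁, h₂, LinearMap.trace_mul_comm]
  | add x y hx hy =>
    rw [add_smul, map_add, LinearMap.add_apply, hx, hy, map_add, MulOpposite.unop_add, add_smul, map_add]

/-- The homomorphisms `p ↦ ξ(p) x`. -/
noncomputable def evalSmul {P : BimodCat K A} (ξ : P →ₗ[EnvAlg K A] EnvAlg K A) :
    (M →ₗ[K] N) →ₗ[K] (P →ₗ[EnvAlg K A] (M →ₗ[K] N)) where
  toFun x := ξ.smulRight x
  map_add' x y := by ext; simp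
  map_smul' k x := by
    refine LinearMap.ext fun p => ?_
    exact smul_comm (ξ p) k x

/-- For a finitely generated projective bimodule `P`, the dual of `Hom_{AA}(P, Hom_K(M, N))` is
`Hom_{AA}(P^∨, Hom_K(N, M))`. -/
noncomputable def homDual (P : BimodCat K A) :
    Module.Dual K (P →ₗ[EnvAlg K A] (M →ₗ[K] N)) →ₗ[K]
      (dualBimod P →ₗ[EnvAlg K A] (N →ₗ[K] M)) where
  toFun φ :=
    { toFun := fun ξ => traceDual.symm (φ ∘ₗ evalSmul N (show P →ₗ[EnvAlg K A] EnvAlg K A from ξ))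
      map_add' := fun ξ η => by
        rw [← map_add]
        congr 1
        ext x
        exact (congrArg φ (LinearMap.ext fun p => add_smul _ _ _)).trans (map_add φ _ _)
      map_smul' := fun e ξ => by
        apply traceDual.injective
        ext x
        rw [RingHom.id_apply, traceDual_smul, LinearEquiv.apply_symm_apply,
          LinearEquiv.apply_symm_apply]
        exact congrArg φ (LinearMap.ext fun p => mul_smul _ _ _) }
  map_add' φ ψ := by
    refine LinearMap.ext fun ξ => ?_
    exact map_add traceDual.symm (φ ∘ₗ _) (ψ ∘ₗ _)
  map_smul' k φ := by
    refine LinearMap.ext fun ξ => ?_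
    exact map_smul traceDual.symm k (φ ∘ₗ _)

variable {N}

lemma traceDual_homDual {P : BimodCat K A}
    (φ : Module.Dual K (P →ₗ[EnvAlg K A] (M →ₗ[K] N))) (ξ : P →ₗ[EnvAlg K A] EnvAlg K A)
    (x : M →ₗ[K] N) :
    traceDual (homDual N P φ (show dualBimod P from ξ)) x = φ (ξ.smulRight x) :=
  LinearMap.congr_fun (LinearEquiv.apply_symm_apply traceDual (φ ∘ₗ evalSmul N ξ)) x

lemma homDual_comp {P Q : BimodCat K A} (f : P ⟶ Q)
    (φ : Module.Dual K (P →ₗ[EnvAlg K A] (M →ₗ[K] N)))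
    (ψ : Module.Dual K (Q →ₗ[EnvAlg K A] (M →ₗ[K] N))) (h : ∀ g, ψ g = φ (g ∘ₗ f.hom)) :
    homDual N Q ψ = homDual N P φ ∘ₗ (dualBimodMap f).hom := by
  refine LinearMap.ext fun ξ => traceDual.injective (LinearMap.ext fun x => ?_)
  refine (traceDual_homDual ψ ξ x).trans ((h _).trans ?_)
  exact (traceDual_homDual φ ((show Q →ₗ[EnvAlg K A] EnvAlg K A from ξ) ∘ₗ f.hom) x).symm

variable (N) in
-- For the free bimodule of rank one this is `traceDual`; a dual basis of `P` reduces the general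
-- case to it. `N` may be infinite-dimensional, which matters when `N` is an ideal.
lemma homDual_bijective (P : BimodCat K A) [Module.Finite (EnvAlg K A) P]
    [Module.Projective (EnvAlg K A) P] : Function.Bijective (homDual (M := M) N P) := by
  obtain ⟨n, p, ξ, hp⟩ := Module.exists_dualBasis (EnvAlg K A) P
  have hf : ∀ f : P →ₗ[EnvAlg K A] (M →ₗ[K] N), f = ∑ j, (ξ j).smulRight (f (p j)) := by
    intro f
    refine LinearMap.ext fun q => ?_
    conv_lhs => rw [← hp q]
    simp [LinearMap.sum_apply]
  refine ⟨(injective_iff_map_eq_zero _).2 fun φ hφ => LinearMap.ext fun f => ?_, fun h => ?_⟩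
  · rw [hf f, map_sum]
    refine Finset.sum_eq_zero fun j _ => ?_
    rw [← traceDual_homDual, hφ]
    exact LinearMap.congr_fun (map_zero traceDual) _
  · let φ : Module.Dual K (P →ₗ[EnvAlg K A] (M →ₗ[K] N)) :=
      { toFun := fun f => ∑ j, traceDual (h (show dualBimod P from ξ j)) (f (p j))
        map_add' := fun f g => by simp [Finset.sum_add_distrib]
        map_smul' := fun k f => by simp [Finset.mul_sum] }
    refine ⟨φ, LinearMap.ext fun η => traceDual.injective (LinearMap.ext fun x => ?_)⟩
    refine (traceDual_homDual φ η x).trans ?_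
    let η' : P →ₗ[EnvAlg K A] EnvAlg K A := η
    -- The dual basis functionals generate the dual bimodule, with coefficients the values η(p j)
    -- transported through the swap.
    have hη : η = ∑ j, (envSwap K A).symm (op (η' (p j))) • (show dualBimod P from ξ j) := by
      let ev : P → (dualBimod P →+ EnvAlg K A) := fun x =>
        { toFun := fun η => (show P →ₗ[EnvAlg K A] EnvAlg K A from η) x
          map_zero' := rfl
          map_add' := fun _ _ => rfl }
      refine LinearMap.ext (M := P) (M₃ := EnvAlg K A) (σ := RingHom.id _) fun q => ?_
      change η' q = ev q _
      rw [map_sum]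
      conv_lhs => rw [← hp q, map_sum]
      refine Finset.sum_congr rfl fun j _ => ?_
      refine Eq.trans ?_ (dualBimod_smul_apply _ (ξ j) q).symm
      simp
    conv_rhs => rw [hη, map_sum, map_sum, LinearMap.sum_apply]
    change ∑ j, traceDual (h (show dualBimod P from ξ j)) (η' (p j) • x) = _
    refine Finset.sum_congr rfl fun j _ => ?_
    rw [map_smul h, traceDual_smul]
    simp

end HomDual

/-! ### Homological consequences of the Calabi-Yau property -/

section CYConsequences

variable {K : Type w} [Field K] {A : Type u} [Ring A] [Algebra K A]

attribute [local instance] homEnvModule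

lemma finiteDimensional_bimodHom (P : BimodCat K A) [Module.Finite (EnvAlg K A) P]
    [Module.Projective (EnvAlg K A) P] (M N : ModuleCat.{u} A) [FiniteDimensional K M]
    [FiniteDimensional K N] : FiniteDimensional K (P →ₗ[EnvAlg K A] (M →ₗ[K] N)) := by
  obtain ⟨n, p, ξ, hp⟩ := Module.exists_dualBasis (EnvAlg K A) P
  let ev : (P →ₗ[EnvAlg K A] (M →ₗ[K] N)) →ₗ[K] (Fin n → M →ₗ[K] N) :=
    { toFun := fun f j => f (p j)
      map_add' := fun _ _ => rfl
      map_smul' := fun _ _ => rfl }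
  refine FiniteDimensional.of_injective ev fun f g hfg => LinearMap.ext fun q => ?_
  rw [← hp q, map_sum, map_sum]
  refine Finset.sum_congr rfl fun j _ => ?_
  rw [map_smul, map_smul]
  exact congrArg _ (congrFun hfg j)

/-- The homomorphism of bimodules `P → Hom_K(N, M)`, `p ↦ ε(p) u`, attached to `u : N → M`. -/
noncomputable def bimodSmulHom {P : BimodCat K A} (ε : P ⟶ regularBimod K A)
    (M N : ModuleCat.{u} A) : (N ⟶ M) →ₗ[K] (P →ₗ[EnvAlg K A] (N →ₗ[K] M)) where
  toFun u :=
    { toFun := fun p => regularToEnd M (ε.hom p) ∘ₗ u.hom.restrictScalars K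
      map_add' := fun p q => by rw [map_add, map_add, LinearMap.add_comp]
      map_smul' := fun e p => by
        ext n
        rw [map_smul, map_smul, RingHom.id_apply]
        induction e using envAlg_induction with
        | zero =>
          have h₁ : ∀ g : M →ₗ[K] M, (0 : EnvAlg K A) • g = 0 :=
            fun g => zero_smul (EnvAlg K A) g
          have h₂ : ∀ g : N →ₗ[K] M, (0 : EnvAlg K A) • g = 0 :=
            fun g => zero_smul (EnvAlg K A) g
          rw [h₁, h₂]
          simp
        | tmul b c =>
          rw [LinearMap.comp_apply, homEnv_smul_apply, homEnv_smul_apply]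
          change b • _ = b • (regularToEnd M (ε.hom p)) (u.hom (c • n))
          rw [map_smul u.hom]
          rfl
        | add x y hx hy =>
          rw [add_smul, add_smul, LinearMap.add_comp, LinearMap.add_apply, LinearMap.add_apply,
            hx, hy] }
  map_add' u v := by
    refine LinearMap.ext fun p => LinearMap.ext fun n => ?_
    exact map_add (regularToEnd M (ε.hom p)) _ _
  map_smul' k u := by
    refine LinearMap.ext fun p => LinearMap.ext fun n => ?_
    exact map_smul (regularToEnd M (ε.hom p)) k _

lemma bimodSmulHom_apply {P : BimodCat K A} (ε : P ⟶ regularBimod K A) (M N : ModuleCat.{u} A)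
    (u : N ⟶ M) (p : P) (n : N) :
    bimodSmulHom ε M N u p n = (show A from ε.hom p) • u.hom n := rfl

lemma bimodSmulHom_injective {P : BimodCat K A} (ε : P ⟶ regularBimod K A)
    (hε : Function.Surjective ε.hom) (M N : ModuleCat.{u} A) :
    Function.Injective (bimodSmulHom ε M N) := fun u v h => by
  obtain ⟨p, hp⟩ := hε (show regularBimod K A from (1 : A))
  ext n
  have := LinearMap.congr_fun (LinearMap.congr_fun h p) n
  rw [bimodSmulHom_apply, bimodSmulHom_apply, hp] at this
  exact (one_smul A (u.hom n)).symm.trans (this.trans (one_smul A (v.hom n)))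

/-- Bimodule maps from `A` to Hom_K(N, M) are the A-linear maps N → M, and Hom is left exact on Q →
P → A → 0. -/
lemma range_bimodSmulHom {P Q : BimodCat K A} (d : Q ⟶ P) (ε : P ⟶ regularBimod K A)
    (hd : Function.Exact d.hom ε.hom) (hε : Function.Surjective ε.hom) (M N : ModuleCat.{u} A)
    (h : P →ₗ[EnvAlg K A] (N →ₗ[K] M)) :
    h ∈ LinearMap.range (bimodSmulHom ε M N) ↔ h ∘ₗ d.hom = 0 := by
  constructor
  · rintro ⟨u, rfl⟩
    refine LinearMap.ext fun q => LinearMap.ext fun n => ?_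
    rw [LinearMap.comp_apply, bimodSmulHom_apply]
    have : (show A from ε.hom (d.hom q)) = (0 : A) := hd.apply_apply_eq_zero q
    rw [this, zero_smul]
    rfl
  · intro hh
    have key : ∀ p q, ε.hom p = ε.hom q → h p = h q := fun p q hpq => by
      rw [← sub_eq_zero, ← map_sub, hd (p - q)] at hpq
      obtain ⟨r, hr⟩ := hpq
      rw [← sub_eq_zero, ← map_sub, ← hr]
      exact LinearMap.congr_fun hh r
    obtain ⟨p₁, hp₁⟩ := hε (show regularBimod K A from (1 : A))
    -- Left and right multiples of p₁ by a have the same image a under ε, so h agrees on them and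
    -- its value at p₁ is A-linear.
    have e₁ : ∀ a : A, ε.hom ((a ⊗ₜ[K] op 1 : EnvAlg K A) • p₁) = a := fun a => by
      rw [map_smul, hp₁, regularBimod_smul]
      exact (congrArg (a * ·) (mul_one (1 : A))).trans (mul_one a)
    have e₂ : ∀ a : A, ε.hom (((1 : A) ⊗ₜ[K] op a : EnvAlg K A) • p₁) = a := fun a => by
      rw [map_smul, hp₁, regularBimod_smul]
      exact (one_mul (M := A) _).trans (one_mul a)
    let u : N →ₗ[A] M :=
      { toFun := h p₁
        map_add' := map_add (h p₁)
        map_smul' := fun a n => by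
          have := LinearMap.congr_fun (key _ _ ((e₁ a).trans (e₂ a).symm)) n
          rw [map_smul, map_smul, homEnv_smul_apply, homEnv_smul_apply, one_smul, one_smul] at this
          exact this.symm }
    refine ⟨ModuleCat.ofHom u, LinearMap.ext fun p => LinearMap.ext fun n => ?_⟩
    rw [bimodSmulHom_apply, key p _ (e₁ (show A from ε.hom p)).symm, map_smul, homEnv_smul_apply,
      one_smul]
    rfl

namespace IsCalabiYau

lemma hasProjectiveDimensionLT (hA : IsCalabiYau K A 2) (M : ModuleCat.{u} A) :
    HasProjectiveDimensionLT M 3 := by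
  obtain ⟨P₂, P₁, P₀, d₂, d₁, ε, ε', f₂, f₁, f₀, h, h'⟩ := hA.exists_resolution
  exact h.hasProjectiveDimensionLT M

/-- Calabi-Yau duality between `Ext²(M, N)` and `Hom(N, M)`. -/
theorem nonempty_equiv_dual_ext_two (hA : IsCalabiYau K A 2) (M N : ModuleCat.{u} A)
    [FiniteDimensional K M] :
    Nonempty ((N ⟶ M) ≃ₗ[K] Module.Dual K (Abelian.Ext.{u} M N 2)) := by
  obtain ⟨P₂, P₁, P₀, d₂, d₁, ε, ε', f₂, f₁, f₀, h, h'⟩ := hA.exists_resolution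
  obtain ⟨δ, hδ, hδ'⟩ := h.exists_ext_two M N
  have := h.projective₂
  have := h.projective₁
  let Λ : Module.Dual K (Abelian.Ext.{u} M N 2) →ₗ[K]
      (dualBimod P₂ →ₗ[EnvAlg K A] (N →ₗ[K] M)) := homDual N P₂ ∘ₗ δ.dualMap
  have hΛ : Function.Injective Λ := (homDual_bijective N P₂).1.comp
    (LinearMap.dualMap_injective_of_surjective hδ)
  -- Both ranges are the kernel of precomposition with the transpose of d₂: one because the dual
  -- complex resolves A, the other because Ext² is a cokernel and dualizing turns it into a kernel.
  have hr : LinearMap.range (bimodSmulHom ε' M N) = LinearMap.range Λ := by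
    ext g
    rw [range_bimodSmulHom (dualBimodMap d₂) ε' h'.exact₀ h'.surjective]
    constructor
    · intro hg
      obtain ⟨φ, rfl⟩ := (homDual_bijective N P₂).2 g
      have h0 : ∀ g₁ : P₁ →ₗ[EnvAlg K A] (M →ₗ[K] N), φ (g₁ ∘ₗ d₂.hom) = 0 := by
        let ψ : Module.Dual K (P₁ →ₗ[EnvAlg K A] (M →ₗ[K] N)) :=
          { toFun := fun g₁ => φ (g₁ ∘ₗ d₂.hom)
            map_add' := fun g g' => map_add φ (g ∘ₗ d₂.hom) (g' ∘ₗ d₂.hom)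
            map_smul' := fun k g => map_smul φ k (g ∘ₗ d₂.hom) }
        have hψ : ψ = 0 := (homDual_bijective N P₁).1 (by
          rw [homDual_comp d₂ φ ψ fun _ => rfl, hg, map_zero])
        exact fun g₁ => LinearMap.congr_fun hψ g₁
      have hker : LinearMap.ker δ ≤ LinearMap.ker φ := fun x hx => by
        obtain ⟨g₁, rfl⟩ := (hδ' x).1 hx
        exact h0 g₁
      obtain ⟨s, hs⟩ := δ.exists_rightInverse_of_surjective (LinearMap.range_eq_top.2 hδ)
      refine ⟨φ ∘ₗ s, congrArg (homDual N P₂) (LinearMap.ext fun x => ?_)⟩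
      have hx : s (δ x) - x ∈ LinearMap.ker δ := by
        rw [LinearMap.mem_ker, map_sub, sub_eq_zero]
        exact LinearMap.congr_fun hs (δ x)
      have := hker hx
      rw [LinearMap.mem_ker, map_sub, sub_eq_zero] at this
      exact this
    · rintro ⟨φ, rfl⟩
      have := homDual_comp (N := N) d₂ (φ ∘ₗ δ) 0 fun g => by
        rw [LinearMap.comp_apply, (hδ' _).2 ⟨g, rfl⟩, map_zero, LinearMap.zero_apply]
      rw [map_zero] at this
      exact this.symm
  exact ⟨(LinearEquiv.ofInjective _ (bimodSmulHom_injective ε' h'.surjective M N)).trans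
    ((LinearEquiv.ofEq _ _ hr).trans (LinearEquiv.ofInjective _ hΛ).symm)⟩

lemma extFinite (hA : IsCalabiYau K A 2) (M N : ModuleCat.{u} A) [FiniteDimensional K M]
    [FiniteDimensional K N] : ExtFinite.{w, u} K M N := by
  obtain ⟨P₂, P₁, P₀, d₂, d₁, ε, ε', f₂, f₁, f₀, h, h'⟩ := hA.exists_resolution
  have := h.projective₂
  have := h.projective₁
  have := h.projective₀
  exact (h.extFinite M N (finiteDimensional_bimodHom P₀ M N) (finiteDimensional_bimodHom P₁ M N)
    (finiteDimensional_bimodHom P₂ M N)).1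

/-- The dual resolution computes χ(N, M) from spaces of the same dimensions in reversed order, and a
three-term alternating sum is unchanged by reversal. -/
lemma eulerForm_symm (hA : IsCalabiYau K A 2) (M N : ModuleCat.{u} A) [FiniteDimensional K M]
    [FiniteDimensional K N] : eulerForm.{w, u} K M N = eulerForm.{w, u} K N M := by
  obtain ⟨P₂, P₁, P₀, d₂, d₁, ε, ε', f₂, f₁, f₀, h, h'⟩ := hA.exists_resolution
  have := h.projective₂
  have := h.projective₁
  have := h.projective₀
  have g₂ := finiteDimensional_bimodHom P₂ M N
  have g₁ := finiteDimensional_bimodHom P₁ M N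
  have g₀ := finiteDimensional_bimodHom P₀ M N
  let e₂ := LinearEquiv.ofBijective _ (homDual_bijective (M := M) N P₂)
  let e₁ := LinearEquiv.ofBijective _ (homDual_bijective (M := M) N P₁)
  let e₀ := LinearEquiv.ofBijective _ (homDual_bijective (M := M) N P₀)
  rw [(h.extFinite M N g₀ g₁ g₂).2, (h'.extFinite N M (LinearEquiv.finiteDimensional e₂)
    (LinearEquiv.finiteDimensional e₁) (LinearEquiv.finiteDimensional e₀)).2,
    ← e₂.finrank_eq, ← e₁.finrank_eq, ← e₀.finrank_eq, Subspace.dual_finrank_eq,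
    Subspace.dual_finrank_eq, Subspace.dual_finrank_eq]
  ring

lemma finrank_ext_two (hA : IsCalabiYau K A 2) (M N : ModuleCat.{u} A) [FiniteDimensional K M] :
    Module.finrank K (Abelian.Ext.{u} M N 2) = Module.finrank K (N ⟶ M) := by
  obtain ⟨e⟩ := hA.nonempty_equiv_dual_ext_two M N
  rw [e.finrank_eq, Subspace.dual_finrank_eq]

lemma subsingleton_ext_two_iff (hA : IsCalabiYau K A 2) (M N : ModuleCat.{u} A)
    [FiniteDimensional K M] :
    Subsingleton (Abelian.Ext.{u} M N 2) ↔ Subsingleton (N ⟶ M) := by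
  obtain ⟨e⟩ := hA.nonempty_equiv_dual_ext_two M N
  rw [e.toEquiv.subsingleton_congr]
  constructor
  · intro _; infer_instance
  · intro hs
    refine subsingleton_of_forall_eq 0 fun x => ?_
    rw [← Module.forall_dual_apply_eq_zero_iff K]
    intro φ
    rw [hs.elim φ 0, LinearMap.zero_apply]

end IsCalabiYau

end CYConsequences

/-! ### Modules annihilated by the annihilator of a simple module -/

section Isotypic

variable {K : Type w} [Field K] {A : Type u} [Ring A] [Algebra K A]

/-- Acting on a K-basis of `M` determines the action on all of `M`. -/
lemma exists_injective_of_annihilator_le {M : Type*} [AddCommGroup M] [Module A M] [Module K M]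
    [IsScalarTower K A M] [FiniteDimensional K M] :
    ∃ (n : ℕ) (f : (A ⧸ Module.annihilator A M) →ₗ[A] (Fin n → M)), Function.Injective f := by
  let b := Module.finBasis K M
  let g : A →ₗ[A] (Fin (Module.finrank K M) → M) :=
    LinearMap.pi fun i => LinearMap.toSpanSingleton A M (b i)
  have hg : LinearMap.ker g = Module.annihilator A M := by
    ext a
    rw [LinearMap.mem_ker, Module.mem_annihilator]
    constructor
    · intro h m
      have ha : (DistribSMul.toLinearMap K M a : M →ₗ[K] M) = 0 :=
        b.ext fun i => congrFun h i
      exact LinearMap.congr_fun ha m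
    · exact fun h => funext fun i => h _
  refine ⟨_, Submodule.liftQ _ g hg.ge, ?_⟩
  rw [← LinearMap.ker_eq_bot, Submodule.ker_liftQ_eq_bot _ _ _ hg.le]

variable (K) (S : Type*) [AddCommGroup S] [Module A S] [Module K S] [IsScalarTower K A S]
  [FiniteDimensional K S] [IsSimpleModule A S]

include K in
lemma isSemisimpleModule_quotient_annihilator :
    IsSemisimpleModule A (A ⧸ Module.annihilator A S) := by
  obtain ⟨n, f, hf⟩ := exists_injective_of_annihilator_le (K := K) (A := A) (M := S)
  exact IsSemisimpleModule.of_injective f hf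

variable {Q : Type*} [AddCommGroup Q] [Module A Q]

include K in
-- `Q` is the sum of its cyclic submodules, all quotients of the semisimple module A / I_S.
lemma isSemisimpleModule_of_annihilator_le
    (h : Module.annihilator A S ≤ Module.annihilator A Q) : IsSemisimpleModule A Q := by
  have := isSemisimpleModule_quotient_annihilator (A := A) K S
  let g : Q → (A ⧸ Module.annihilator A S) →ₗ[A] Q := fun x =>
    Submodule.liftQ _ (LinearMap.toSpanSingleton A Q x) fun a ha =>
      Module.mem_annihilator.1 (h ha) x
  refine isSemisimpleModule_of_isSemisimpleModule_submodule' (p := fun x => LinearMap.range (g x))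
    (fun x => IsSemisimpleModule.of_surjective _ (g x).surjective_rangeRestrict) (eq_top_iff.2 fun x _ => ?_)
  refine Submodule.mem_iSup_of_mem x ⟨Submodule.Quotient.mk 1, ?_⟩
  exact one_smul A x

include K in
/-- Homomorphisms to the simple module `S` separate the elements of a module that is annihilated
by the annihilator of `S`. -/
lemma exists_hom_apply_ne_zero (h : Module.annihilator A S ≤ Module.annihilator A Q) {x : Q}
    (hx : x ≠ 0) : ∃ φ : Q →ₗ[A] S, φ x ≠ 0 := by
  have := isSemisimpleModule_quotient_annihilator (A := A) K S
  have hQ := isSemisimpleModule_of_annihilator_le (A := A) K S h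
  obtain ⟨n, f, hf⟩ := exists_injective_of_annihilator_le (K := K) (A := A) (M := S)
  let g : (A ⧸ Module.annihilator A S) →ₗ[A] Q :=
    Submodule.liftQ _ (LinearMap.toSpanSingleton A Q x) fun a ha =>
      Module.mem_annihilator.1 (h ha) x
  have hg : g (Submodule.Quotient.mk 1) = x := one_smul A x
  let N := LinearMap.range g
  obtain ⟨r, hr⟩ := IsSemisimpleModule.extension_property N.subtype N.injective_subtype LinearMap.id
  obtain ⟨s, hs⟩ := IsSemisimpleModule.lifting_property g.rangeRestrict
    g.surjective_rangeRestrict LinearMap.id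
  let x' : N := ⟨x, _, hg⟩
  -- Retract Q onto the cyclic module of x, lift it into A / I_S and embed that in a power of S;
  -- some coordinate does not kill x.
  have hx' : f (s (r x)) ≠ 0 := fun h0 => hx (by
    have h1 : r x = x' := LinearMap.congr_fun hr x'
    have h2 : s x' = 0 := by
      rw [h1] at h0
      exact (map_eq_zero_iff f hf).1 h0
    have h3 : g.rangeRestrict (s x') = x' := LinearMap.congr_fun hs x'
    rw [h2, map_zero] at h3
    exact (congrArg Subtype.val h3).symm)
  obtain ⟨i, hi⟩ := Function.ne_iff.1 hx'
  exact ⟨LinearMap.proj i ∘ₗ f ∘ₗ s ∘ₗ r, hi⟩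

include K in
-- A nonzero map to `S` is onto, and it splits because `Q` is semisimple.
lemma exists_hom_ne_zero_of_annihilator_le
    (h : Module.annihilator A S ≤ Module.annihilator A Q) {x : Q} (hx : x ≠ 0) :
    ∃ φ : S →ₗ[A] Q, φ ≠ 0 := by
  have := isSemisimpleModule_of_annihilator_le (A := A) K S h
  obtain ⟨φ, hφ⟩ := exists_hom_apply_ne_zero (A := A) K S h hx
  have hs : Function.Surjective φ :=
    φ.surjective_or_eq_zero.resolve_right fun h0 => hφ (by rw [h0, LinearMap.zero_apply])
  obtain ⟨s, hs⟩ := IsSemisimpleModule.lifting_property φ hs LinearMap.id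
  refine ⟨s, fun h0 => hφ ?_⟩
  have := LinearMap.congr_fun hs (φ x)
  rw [h0] at this
  simpa using this.symm

end Isotypic

/-! ### Powers of a module -/

section Powers

variable {K : Type w} [Field K] {A : Type u} [Ring A] [Algebra K A]

lemma ModuleCat.finiteDimensional_of_shortExact {T : ShortComplex (ModuleCat.{u} A)}
    (hT : T.ShortExact) (h₁ : FiniteDimensional K T.X₁) (h₃ : FiniteDimensional K T.X₃) :
    FiniteDimensional K T.X₂ :=
  FiniteDimensional.of_exact (f := T.f.hom.restrictScalars K) (g := T.g.hom.restrictScalars K)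
    ((ShortComplex.ShortExact.moduleCat_exact_iff_function_exact _).1 hT.exact)

/-- The direct sum of `n` copies of `S`. -/
def powModule (S : ModuleCat.{u} A) (n : ℕ) : ModuleCat.{u} A := ModuleCat.of A (Fin n → S)

instance (S : ModuleCat.{u} A) : Subsingleton (powModule S 0) :=
  inferInstanceAs (Subsingleton (Fin 0 → S))

lemma subsingleton_ext_powModule_zero (S T : ModuleCat.{u} A) (m : ℕ) :
    Subsingleton (Abelian.Ext.{u} (powModule S 0) T m) :=
  have := (ModuleCat.isZero_of_subsingleton (powModule S 0)).hasProjectiveDimensionLT_zero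
  HasProjectiveDimensionLT.subsingleton _ 0 m (Nat.zero_le m) T

lemma powModule_shortExact (S : ModuleCat.{u} A) (n : ℕ) :
    ∃ (i : S ⟶ powModule S (n + 1)) (q : powModule S (n + 1) ⟶ powModule S n) (h : i ≫ q = 0),
      (ShortComplex.mk i q h).ShortExact := by
  let i : S →ₗ[A] (Fin (n + 1) → S) := LinearMap.single A (fun _ => S) 0
  let q : (Fin (n + 1) → S) →ₗ[A] (Fin n → S) := LinearMap.funLeft A S Fin.succ
  refine ⟨ModuleCat.ofHom i, ModuleCat.ofHom q, ModuleCat.shortExact_mk _ _ ?_ ?_ ?_⟩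
  · exact Pi.single_injective (M := fun _ => S) 0
  · intro (x : Fin (n + 1) → S)
    constructor
    · intro h
      refine ⟨x 0, funext fun j => ?_⟩
      cases j using Fin.cases with
      | zero => exact Pi.single_eq_same (M := fun _ : Fin (n + 1) => S) 0 (x 0)
      | succ j => exact (Pi.single_eq_of_ne (M := fun _ => S) (Fin.succ_ne_zero j) (x 0)).trans (congrFun h j).symm
    · rintro ⟨y, rfl⟩
      exact funext fun j => Pi.single_eq_of_ne (M := fun _ => S) (Fin.succ_ne_zero j) y
  · intro (x : Fin n → S)
    exact ⟨(Fin.cons 0 x : Fin (n + 1) → S), rfl⟩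

instance finiteDimensional_powModule (S : ModuleCat.{u} A) [FiniteDimensional K S] (n : ℕ) :
    FiniteDimensional K (powModule S n) := by
  induction n with
  | zero => infer_instance
  | succ n ih =>
    obtain ⟨i, q, h, hT⟩ := powModule_shortExact S n
    exact ModuleCat.finiteDimensional_of_shortExact hT inferInstance ih

lemma subsingleton_ext_powModule (S T : ModuleCat.{u} A) (m : ℕ)
    (h : Subsingleton (Abelian.Ext.{u} S T m)) (n : ℕ) :
    Subsingleton (Abelian.Ext.{u} (powModule S n) T m) := by
  induction n with
  | zero => exact subsingleton_ext_powModule_zero S T m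
  | succ n ih =>
    obtain ⟨i, q, w, hT⟩ := powModule_shortExact S n
    refine subsingleton_of_forall_eq 0 fun x => ?_
    obtain ⟨y, rfl⟩ := Abelian.Ext.contravariant_sequence_exact₂ hT T x (h.elim _ _)
    rw [ih.elim y 0, Abelian.Ext.comp_zero]

lemma extFinite_powModule {S T : ModuleCat.{u} A} (h : ExtFinite.{w, u} K S T) (n : ℕ) :
    ExtFinite.{w, u} K (powModule S n) T := by
  induction n with
  | zero =>
    intro m
    have := subsingleton_ext_powModule_zero S T m
    infer_instance
  | succ n ih =>
    obtain ⟨i, q, w, hT⟩ := powModule_shortExact S n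
    exact ExtFinite.of_shortExact₂ hT h ih

lemma eulerForm_powModule {S T : ModuleCat.{u} A} (h : ExtFinite.{w, u} K S T)
    (hd : ∀ M : ModuleCat.{u} A, HasProjectiveDimensionLT M 3) (n : ℕ) :
    eulerForm.{w, u} K (powModule S n) T = n * eulerForm.{w, u} K S T := by
  induction n with
  | zero =>
    have h0 : ∀ m, Module.finrank K (Abelian.Ext.{u} (powModule S 0) T m) = 0 := fun m => by
      have : Subsingleton (Abelian.Ext.{u} (powModule S 0) T m) :=
        subsingleton_ext_powModule_zero S T m
      exact Module.finrank_zero_of_subsingleton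
    simp [eulerForm, h0]
  | succ n ih =>
    obtain ⟨i, q, w, hT⟩ := powModule_shortExact S n
    have := hd (powModule S n)
    rw [eulerForm_shortExact (K := K) hT h (extFinite_powModule h n), ih]
    push_cast
    ring

/-- The projections from a power of a module. -/
def powModuleProj (S : ModuleCat.{u} A) (n : ℕ) (j : Fin n) : powModule S n ⟶ S :=
  ModuleCat.ofHom (LinearMap.proj (φ := fun _ : Fin n => S) j)

lemma powModule_hom_ext {M S : ModuleCat.{u} A} {n : ℕ} {f g : M ⟶ powModule S n}
    (h : ∀ φ : powModule S n ⟶ S, f ≫ φ = g ≫ φ) : f = g := by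
  ext x
  refine funext fun j => ?_
  exact congr($(h (powModuleProj S n j)) x)

end Powers

/-! ### Ideals and their products with annihilators of simple modules -/

section Rigidity

open Abelian

variable {C : Type*} [Category* C] [Abelian C] [HasExt.{u} C]

/-- If `X₁` is the kernel of a morphism `X₂ ⟶ X₃` through which all morphisms `X₂ ⟶ X₃` factor,
then `X₁` inherits rigidity from `X₂`. -/
lemma subsingleton_ext_one_of_shortExact {S : ShortComplex C} (hS : S.ShortExact)
    (h₂ : Subsingleton (Ext.{u} S.X₂ S.X₂ 1)) (h₃ : Subsingleton (Ext.{u} S.X₃ S.X₁ 2))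
    (hf : ∀ φ : S.X₂ ⟶ S.X₃, ∃ ψ, φ = S.g ≫ ψ) : Subsingleton (Ext.{u} S.X₁ S.X₁ 1) := by
  refine subsingleton_of_forall_eq 0 fun x => ?_
  -- The class extends to X₂ by `h₃`, then comes from a map X₂ ⟶ X₃ by `h₂`. That map factors
  -- through g, so it vanishes on X₁.
  obtain ⟨y, rfl⟩ := Ext.contravariant_sequence_exact₁ hS _ x rfl (h₃.elim _ _)
  obtain ⟨z, rfl⟩ := Ext.covariant_sequence_exact₁ _ hS y (h₂.elim _ _) rfl
  obtain ⟨φ, rfl⟩ := Ext.addEquiv₀.symm.surjective z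
  obtain ⟨ψ, rfl⟩ := hf φ
  change (Ext.mk₀ S.f).comp ((Ext.mk₀ (S.g ≫ ψ)).comp hS.extClass rfl) _ = 0
  rw [Ext.mk₀_comp_mk₀_assoc, S.zero_assoc, Limits.zero_comp, Ext.mk₀_zero, Ext.zero_comp]

/-- A rigid object of projective dimension at most one has no extensions by its quotients. -/
lemma subsingleton_ext_one_of_epi {X Y : C} (f : X ⟶ Y) [Epi f] [HasProjectiveDimensionLT X 2]
    (h : Subsingleton (Ext.{u} X X 1)) : Subsingleton (Ext.{u} X Y 1) := by
  have hS : (ShortComplex.mk (Limits.kernel.ι f) f (Limits.kernel.condition f)).ShortExact :=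
    { exact := ShortComplex.exact_kernel f }
  refine subsingleton_of_forall_eq 0 fun x => ?_
  have : Subsingleton (Ext.{u} X (Limits.kernel f) 2) :=
    HasProjectiveDimensionLT.subsingleton _ 2 2 le_rfl _
  obtain ⟨y, rfl⟩ := Ext.covariant_sequence_exact₃ X hS x (n₁ := 2) rfl (this.elim _ _)
  rw [h.elim y 0, Ext.zero_comp]

end Rigidity

/-! ### The universal quotient of an ideal by its product with I_S. -/

section IdealModule

variable {K : Type w} [Field K] {A : Type u} [Ring A] [Algebra K A]

/-- A left ideal as a module. -/
def idealModule (J : Ideal A) : ModuleCat.{u} A := ModuleCat.of A J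

/-- The quotient by a left ideal as a module. -/
def quotModule (J : Ideal A) : ModuleCat.{u} A := ModuleCat.of A (A ⧸ J)

/-- The inclusion of left ideals. -/
def idealIncl {I J : Ideal A} (h : I ≤ J) : idealModule I ⟶ idealModule J :=
  ModuleCat.ofHom (Submodule.inclusion h)

lemma quotModule_shortExact (J : Ideal A) :
    ∃ (i : idealModule J ⟶ ModuleCat.of A A) (q : ModuleCat.of A A ⟶ quotModule J) (h : i ≫ q = 0),
      (ShortComplex.mk i q h).ShortExact :=
  ⟨ModuleCat.ofHom J.subtype, ModuleCat.ofHom J.mkQ, ModuleCat.shortExact_mk _ _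
    J.injective_subtype (LinearMap.exact_subtype_mkQ J) (Submodule.mkQ_surjective J)⟩

instance projective_of_self : Projective (ModuleCat.of A A) :=
  (IsProjective.iff_projective A).1 inferInstance

/-- The short exact sequence `0 → I_S J → J → S^k → 0` with `k = dim Hom(J, S)`. -/
lemma exists_idealModule_shortExact (S : ModuleCat.{u} A) [IsSimpleModule A S]
    [FiniteDimensional K S] (hS : Function.Bijective (algebraMap K (Module.End A S)))
    (J : Ideal A) [FiniteDimensional K (idealModule J ⟶ S)] :
    ∃ (q : idealModule J ⟶ powModule S (Module.finrank K (idealModule J ⟶ S)))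
      (h : idealIncl (Ideal.mul_le_right (I := Module.annihilator A S)) ≫ q = 0),
      (ShortComplex.mk _ q h).ShortExact ∧ ∀ φ : idealModule J ⟶ S, ∃ ψ, φ = q ≫ ψ := by
  let b := Module.finBasis K (idealModule J ⟶ S)
  let g : J →ₗ[A] (Fin (Module.finrank K (idealModule J ⟶ S)) → S) :=
    LinearMap.pi fun i => (b i).hom
  let q : idealModule J ⟶ powModule S (Module.finrank K (idealModule J ⟶ S)) := ModuleCat.ofHom g
  have hker : ∀ φ : idealModule J ⟶ S, ∃ ψ : powModule S (Module.finrank K (idealModule J ⟶ S)) ⟶ S,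
      φ = q ≫ ψ := fun φ => by
    let pr : ∀ i, powModule S (Module.finrank K (idealModule J ⟶ S)) ⟶ S := fun i =>
      ModuleCat.ofHom (LinearMap.proj (φ := fun _ => S) i)
    refine ⟨∑ i, b.repr φ i • pr i, ?_⟩
    conv_lhs => rw [← b.sum_repr φ]
    rw [Preadditive.comp_sum]
    refine Finset.sum_congr rfl fun i _ => ?_
    rw [Linear.comp_smul]
    rfl
  suffices h : Function.Exact (idealIncl (Ideal.mul_le_right (I := Module.annihilator A S)
      (J := J))).hom q.hom ∧ Function.Surjective q.hom by
    obtain ⟨h₁, h₂⟩ := ModuleCat.shortExact_mk _ q (Submodule.inclusion_injective Ideal.mul_le_right)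
      h.1 h.2
    exact ⟨q, h₁, h₂, hker⟩
  refine ⟨fun (x : J) => ?_, ?_⟩
  · constructor
    -- J / I_S J is annihilated by I_S, so maps to S separate its elements, and every such map
    -- factors through q.
    · intro hx
      by_contra hx'
      have hx₁ : (Submodule.Quotient.mk x : J ⧸ (Module.annihilator A S • ⊤ : Submodule A J)) ≠ 0 :=
        fun h0 => hx' (by
          rw [Submodule.Quotient.mk_eq_zero, Submodule.mem_smul_top_iff] at h0
          exact ⟨⟨x.1, h0⟩, rfl⟩)
      obtain ⟨φ, hφ⟩ := exists_hom_apply_ne_zero (A := A) K S (fun a ha =>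
        Module.mem_annihilator.2 fun y => by
          obtain ⟨y, rfl⟩ := Submodule.Quotient.mk_surjective _ y
          rw [← Submodule.Quotient.mk_smul, Submodule.Quotient.mk_eq_zero]
          exact Submodule.smul_mem_smul ha Submodule.mem_top) hx₁
      obtain ⟨ψ, hψ⟩ := hker (ModuleCat.ofHom (φ ∘ₗ Submodule.mkQ _))
      refine hφ ?_
      have : φ (Submodule.Quotient.mk x) = ψ.hom (g x) := congr($hψ x)
      rw [this]
      exact (congrArg ψ.hom hx).trans (map_zero _)
    · rintro ⟨⟨y, hy⟩, rfl⟩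
      refine funext fun i => ?_
      have : ∀ (z : J), z ∈ (Module.annihilator A S • ⊤ : Submodule A J) → (b i).hom z = 0 := by
        intro z hz
        induction hz using Submodule.smul_induction_on' with
        | smul a ha n hn => exact (map_smul (b i).hom a n).trans (Module.mem_annihilator.1 ha _)
        | add x hx y hy h1 h2 =>
          exact (map_add (b i).hom x y).trans ((congrArg₂ (· + ·) h1 h2).trans (add_zero 0))
      exact this ⟨y, Ideal.mul_le_right hy⟩ ((Submodule.mem_smul_top_iff _ _ _).2 hy)
  · change Function.Surjective g
    rw [← LinearMap.range_eq_top]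
    by_contra hne
    obtain ⟨x, hx⟩ : ∃ x, x ∉ LinearMap.range g := by
      by_contra! h
      exact hne (eq_top_iff.2 fun x _ => h x)
    obtain ⟨φ, hφ⟩ := exists_hom_apply_ne_zero (A := A) K S (fun a ha =>
      Module.mem_annihilator.2 fun y => by
        obtain ⟨y, rfl⟩ := Submodule.Quotient.mk_surjective (LinearMap.range g) y
        rw [← Submodule.Quotient.mk_smul]
        have : a • y = 0 := funext fun j => Module.mem_annihilator.1 ha _
        rw [this, Submodule.Quotient.mk_zero])
        (mt (Submodule.Quotient.mk_eq_zero (LinearMap.range g)).1 hx)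
    -- Splitness makes a map S^k → S a tuple of scalars. One that kills the image of J is a linear
    -- relation between the basis maps, hence zero.
    choose c hc using fun i => hS.2 (φ ∘ₗ Submodule.mkQ _ ∘ₗ LinearMap.single A (fun _ => S) i)
    have hsum : ∀ y, φ (Submodule.Quotient.mk y) = ∑ i, c i • y i := fun y => by
      conv_lhs => rw [← Finset.univ_sum_single y]
      rw [← Submodule.mkQ_apply, map_sum, map_sum]
      refine Finset.sum_congr rfl fun i _ => ?_
      exact (LinearMap.congr_fun (hc i) (y i)).symm
    have hlin : ∑ i, c i • b i = 0 := by
      ext z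
      have h1 := hsum (g z)
      rw [(Submodule.Quotient.mk_eq_zero (LinearMap.range g)).2 ⟨z, rfl⟩, map_zero] at h1
      rw [ModuleCat.hom_sum, LinearMap.sum_apply]
      exact h1.symm
    have hc0 := Fintype.linearIndependent_iff.1 b.linearIndependent c hlin
    exact hφ (by rw [hsum]; simp [hc0])

end IdealModule

/-! ### Rigid ideals of finite codimension -/

section RigidIdeals

open Abelian

variable (K : Type w) [Field K] {A : Type u} [Ring A] [Algebra K A]

/-- A finite-dimensional simple module that is rigid and split. -/
structure IsSplitRigid (S : ModuleCat.{u} A) : Prop where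
  simple : IsSimpleModule A S
  finite : FiniteDimensional K S
  rigid : Subsingleton (Ext.{u} S S 1)
  split : Function.Bijective (algebraMap K (Module.End A S))

/-- A left ideal of finite codimension that is rigid as a module. -/
structure IsRigidIdeal (J : Ideal A) : Prop where
  finite : FiniteDimensional K (quotModule J)
  rigid : Subsingleton (Ext.{u} (idealModule J) (idealModule J) 1)

variable {K}

lemma finiteDimensional_hom_of_self (S : ModuleCat.{u} A) [FiniteDimensional K S] :
    FiniteDimensional K (ModuleCat.of A A ⟶ S) := by
  let ev : (ModuleCat.of A A ⟶ S) →ₗ[K] S :=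
    { toFun := fun f => f.hom (1 : A)
      map_add' := fun _ _ => rfl
      map_smul' := fun _ _ => rfl }
  exact FiniteDimensional.of_injective ev fun f g h =>
    ModuleCat.hom_ext (LinearMap.ext_ring h)

namespace IsSplitRigid

variable {S T : ModuleCat.{u} A}

lemma finrank_end (hS : IsSplitRigid K S) : Module.finrank K (S ⟶ S) = 1 := by
  have := hS.simple
  have := IsSimpleModule.nontrivial A S
  obtain ⟨x, hx⟩ := exists_ne (0 : S)
  have h_id : (𝟙 S : S ⟶ S) ≠ 0 := fun h => hx congr($h x)
  refine finrank_eq_one (𝟙 S) h_id fun f => ?_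
  obtain ⟨c, hc⟩ := hS.split.2 f.hom
  refine ⟨c, ModuleCat.hom_ext (LinearMap.ext fun y => ?_)⟩
  exact LinearMap.congr_fun hc y

lemma subsingleton_hom (hS : IsSplitRigid K S) (hT : IsSplitRigid K T) (h : IsEmpty (S ≅ T)) :
    Subsingleton (S ⟶ T) := by
  have := hS.simple
  have := hT.simple
  refine subsingleton_of_forall_eq 0 fun f => ?_
  by_contra hf
  have hb : Function.Bijective f.hom := f.hom.bijective_or_eq_zero.resolve_right fun h =>
    hf (ModuleCat.hom_ext h)
  exact h.elim (LinearEquiv.ofBijective f.hom hb).toModuleIso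

lemma eulerForm_self (hA : IsCalabiYau K A 2) (hS : IsSplitRigid K S) :
    eulerForm.{w, u} K S S = 2 := by
  have := hS.rigid
  have := hS.finite
  rw [eulerForm, hA.finrank_ext_two, (Ext.linearEquiv₀ (R := K)).finrank_eq, hS.finrank_end,
    Module.finrank_zero_of_subsingleton]
  norm_num

lemma eulerForm_eq_neg (hA : IsCalabiYau K A 2) (hS : IsSplitRigid K S) (hT : IsSplitRigid K T)
    (h : IsEmpty (S ≅ T)) :
    eulerForm.{w, u} K S T = - (Module.finrank K (Ext.{u} S T 1) : ℤ) := by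
  have := hS.finite
  have := hS.subsingleton_hom hT h
  have := hT.subsingleton_hom hS ⟨fun e => h.elim e.symm⟩
  rw [eulerForm, hA.finrank_ext_two, (Ext.linearEquiv₀ (R := K)).finrank_eq,
    Module.finrank_zero_of_subsingleton (M := S ⟶ T),
    Module.finrank_zero_of_subsingleton (M := T ⟶ S)]
  simp

end IsSplitRigid

namespace IsRigidIdeal

variable {J J' : Ideal A} {S T : ModuleCat.{u} A}

/-- `J` is a first syzygy of A/J, which has projective dimension at most two. -/
lemma hasProjectiveDimensionLT (hA : IsCalabiYau K A 2) (J : Ideal A) :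
    HasProjectiveDimensionLT (idealModule J) 2 := by
  obtain ⟨i, q, h, hT⟩ := quotModule_shortExact J
  exact hT.hasProjectiveDimensionLT_X₁ 2
    (hasProjectiveDimensionLT_of_ge (ModuleCat.of A A) 1 2 (by norm_num))
    (hA.hasProjectiveDimensionLT _)

lemma extFinite (hA : IsCalabiYau K A 2) (hJ : IsRigidIdeal K J) (S : ModuleCat.{u} A)
    [FiniteDimensional K S] : ExtFinite.{w, u} K (idealModule J) S := by
  obtain ⟨i, q, h, hT⟩ := quotModule_shortExact J
  have := hJ.finite
  exact ExtFinite.of_shortExact₁ hT (ExtFinite.of_projective (finiteDimensional_hom_of_self S))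
    (hA.extFinite _ _)

lemma finiteDimensional_hom (hA : IsCalabiYau K A 2) (hJ : IsRigidIdeal K J) (S : ModuleCat.{u} A)
    [FiniteDimensional K S] : FiniteDimensional K (idealModule J ⟶ S) :=
  have := hJ.extFinite hA S 0
  LinearEquiv.finiteDimensional (Ext.linearEquiv₀ (R := K))

lemma subsingleton_ext_one (hA : IsCalabiYau K A 2) (hJ : IsRigidIdeal K J)
    (hS : IsSplitRigid K S) (h : Nontrivial (idealModule J ⟶ S)) :
    Subsingleton (Ext.{u} (idealModule J) S 1) := by
  have := hS.simple
  have := hasProjectiveDimensionLT hA J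
  obtain ⟨f, hf⟩ := exists_ne (0 : idealModule J ⟶ S)
  have : Epi f := (ModuleCat.epi_iff_surjective f).2
    (f.hom.surjective_or_eq_zero.resolve_right fun h => hf (ModuleCat.hom_ext h))
  exact subsingleton_ext_one_of_epi f hJ.rigid

lemma eulerForm_eq (hA : IsCalabiYau K A 2) (hJ : IsRigidIdeal K J)
    (hS : IsSplitRigid K S) (h : Nontrivial (idealModule J ⟶ S)) :
    eulerForm.{w, u} K (idealModule J) S = Module.finrank K (idealModule J ⟶ S) := by
  have := hJ.subsingleton_ext_one hA hS h
  have := hasProjectiveDimensionLT hA J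
  have : Subsingleton (Ext.{u} (idealModule J) S 2) :=
    HasProjectiveDimensionLT.subsingleton _ 2 2 le_rfl _
  rw [eulerForm, (Ext.linearEquiv₀ (R := K)).finrank_eq,
    Module.finrank_zero_of_subsingleton (M := Ext.{u} (idealModule J) S 1),
    Module.finrank_zero_of_subsingleton (M := Ext.{u} (idealModule J) S 2)]
  simp

/-- Ext² from `J` vanishes. If Hom is zero, then χ is minus the dimension of Ext¹; if not, then Ext¹
is zero. -/
lemma eulerForm_pos_iff (hA : IsCalabiYau K A 2) (hJ : IsRigidIdeal K J)
    (hS : IsSplitRigid K S) :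
    0 < eulerForm.{w, u} K (idealModule J) S ↔ Nontrivial (idealModule J ⟶ S) := by
  have := hS.finite
  have := hJ.finiteDimensional_hom hA S
  constructor
  · intro h
    by_contra hn
    rw [not_nontrivial_iff_subsingleton] at hn
    have := hasProjectiveDimensionLT hA J
    have : Subsingleton (Ext.{u} (idealModule J) S 2) :=
      HasProjectiveDimensionLT.subsingleton _ 2 2 le_rfl _
    rw [eulerForm, (Ext.linearEquiv₀ (R := K)).finrank_eq,
      Module.finrank_zero_of_subsingleton (M := idealModule J ⟶ S),
      Module.finrank_zero_of_subsingleton (M := Ext.{u} (idealModule J) S 2)] at h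
    omega
  · intro h
    rw [hJ.eulerForm_eq hA hS h]
    exact_mod_cast Module.finrank_pos

lemma mul_eq_of_nonpos (hA : IsCalabiYau K A 2) (hJ : IsRigidIdeal K J) (hS : IsSplitRigid K S)
    (h : eulerForm.{w, u} K (idealModule J) S ≤ 0) : Module.annihilator A S * J = J := by
  have := hS.simple
  have := hS.finite
  have := hJ.finiteDimensional_hom hA S
  rw [← not_lt, hJ.eulerForm_pos_iff hA hS, not_nontrivial_iff_subsingleton] at h
  obtain ⟨q, w, hT, -⟩ := exists_idealModule_shortExact S hS.split J
  have hq : Subsingleton (powModule S (Module.finrank K (idealModule J ⟶ S))) := by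
    rw [Module.finrank_zero_of_subsingleton]
    infer_instance
  refine le_antisymm Ideal.mul_le_right fun x hx => ?_
  obtain ⟨y, hy⟩ := ((ShortComplex.ShortExact.moduleCat_exact_iff_function_exact _).1 hT.exact
    (⟨x, hx⟩ : J)).1 (hq.elim _ _)
  have hyx : y.1 = x := congrArg Subtype.val hy
  exact hyx ▸ y.2

lemma top (K : Type w) [Field K] {A : Type u} [Ring A] [Algebra K A] :
    IsRigidIdeal K (⊤ : Ideal A) where
  finite := by
    have : Subsingleton (quotModule (⊤ : Ideal A)) :=
      Submodule.Quotient.subsingleton_iff.2 rfl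
    infer_instance
  rigid := by
    have : Projective (idealModule (⊤ : Ideal A)) :=
      Projective.of_iso (Submodule.topEquiv (R := A) (M := A)).symm.toModuleIso projective_of_self
    exact subsingleton_of_forall_eq 0 Ext.eq_zero_of_projective

lemma eulerForm_top_pos (hA : IsCalabiYau K A 2) (hS : IsSplitRigid K S) :
    0 < eulerForm.{w, u} K (idealModule (⊤ : Ideal A)) S := by
  rw [(top K).eulerForm_pos_iff hA hS]
  have := hS.simple
  have := IsSimpleModule.nontrivial A S
  obtain ⟨x, hx⟩ := exists_ne (0 : S)
  refine ⟨ModuleCat.ofHom (LinearMap.toSpanSingleton A S x ∘ₗ Submodule.subtype _), 0, fun h => hx ?_⟩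
  have : (1 : A) • x = 0 := congr($h (⟨1, Submodule.mem_top⟩ : (⊤ : Ideal A)))
  rwa [one_smul] at this

/-- A map I_S J → S extends to `J` because Ext¹(S^k, S) = 0. Maps J → S factor through S^k, so the
restriction to I_S J is zero. -/
lemma subsingleton_hom_mul (hA : IsCalabiYau K A 2) (hJ : IsRigidIdeal K J)
    (hS : IsSplitRigid K S) : Subsingleton (idealModule (Module.annihilator A S * J) ⟶ S) := by
  have := hS.simple
  have := hS.finite
  have := hJ.finiteDimensional_hom hA S
  obtain ⟨q, w, hT, hq⟩ := exists_idealModule_shortExact S hS.split J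
  refine subsingleton_of_forall_eq 0 fun x => ?_
  obtain ⟨y, hy⟩ := Ext.contravariant_sequence_exact₁ hT S (Ext.mk₀ x) (n₁ := 1) rfl
    ((subsingleton_ext_powModule S S 1 hS.rigid _).elim _ _)
  obtain ⟨φ, rfl⟩ := Ext.addEquiv₀.symm.surjective y
  obtain ⟨ψ, rfl⟩ := hq φ
  change (Ext.mk₀ _).comp (Ext.mk₀ _) _ = _ at hy
  rw [Ext.mk₀_comp_mk₀, ← Category.assoc, w, Limits.zero_comp] at hy
  exact (Ext.mk₀_bijective _ _).1 hy.symm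

/-- The kernel of A / I_S J → A / J is an image of the finite-dimensional S^k. -/
lemma finite_quotModule_mul (hA : IsCalabiYau K A 2) (hJ : IsRigidIdeal K J)
    (hS : IsSplitRigid K S) :
    FiniteDimensional K (quotModule (Module.annihilator A S * J)) := by
  have := hS.simple
  have := hS.finite
  have := hJ.finite
  have := hJ.finiteDimensional_hom hA S
  obtain ⟨q, w, hT, -⟩ := exists_idealModule_shortExact S hS.split J
  have hq : Function.Surjective q.hom := (ModuleCat.epi_iff_surjective q).1 hT.epi_g
  let I := Module.annihilator A S * J
  let i : idealModule J ⟶ quotModule I := ModuleCat.ofHom (Submodule.mkQ I ∘ₗ J.subtype)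
  have hi : idealIncl (Ideal.mul_le_right : I ≤ J) ≫ i = 0 := by
    ext x
    exact (Submodule.Quotient.mk_eq_zero _).2 x.2
  have := hT.epi_g
  let m : powModule S (Module.finrank K (idealModule J ⟶ S)) ⟶ quotModule I := hT.exact.desc i hi
  have hm : q ≫ m = i := hT.exact.g_desc i hi
  let p : quotModule I ⟶ quotModule J :=
    ModuleCat.ofHom (Submodule.factor (Ideal.mul_le_right : I ≤ J))
  refine FiniteDimensional.of_exact (f := m.hom.restrictScalars K) (g := p.hom.restrictScalars K)
    fun x => ?_
  obtain ⟨x, rfl⟩ := Submodule.Quotient.mk_surjective I x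
  constructor
  · intro hx
    have hx : x ∈ J := (Submodule.Quotient.mk_eq_zero J).1 hx
    exact ⟨q.hom (⟨x, hx⟩ : J), congr($hm (⟨x, hx⟩ : J))⟩
  · rintro ⟨y, hy⟩
    obtain ⟨z, rfl⟩ := hq y
    rw [← hy]
    have : m.hom (q.hom z) = i.hom z := congr($hm z)
    change p.hom (m.hom (q.hom z)) = 0
    rw [this]
    exact (Submodule.Quotient.mk_eq_zero J).2 z.2

/-- The obstruction space Ext²(S^k, I_S J) is controlled by Hom(I_S J, S^k), which vanishes by
`subsingleton_hom_mul`; the sequence defining I_S J then transfers rigidity from `J`. -/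
lemma mul (hA : IsCalabiYau K A 2) (hJ : IsRigidIdeal K J) (hS : IsSplitRigid K S) :
    IsRigidIdeal K (Module.annihilator A S * J) where
  finite := hJ.finite_quotModule_mul hA hS
  rigid := by
    have := hS.simple
    have := hS.finite
    have := hJ.finiteDimensional_hom hA S
    obtain ⟨q, w, hT, hq⟩ := exists_idealModule_shortExact S hS.split J
    refine subsingleton_ext_one_of_shortExact hT hJ.rigid ?_ fun φ => ?_
    · have h0 := hJ.subsingleton_hom_mul hA hS
      exact (hA.subsingleton_ext_two_iff _ _).2
        ⟨fun f g => powModule_hom_ext fun φ => h0.elim _ _⟩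
    · choose ψ hψ using fun j => hq (φ ≫ powModuleProj S _ j)
      refine ⟨ModuleCat.ofHom (LinearMap.pi fun j => (ψ j).hom), ?_⟩
      ext x
      exact funext fun j => congr($(hψ j) x)

lemma eulerForm_mul (hA : IsCalabiYau K A 2) (hJ : IsRigidIdeal K J) (hS : IsSplitRigid K S)
    (hT : IsSplitRigid K T) (h : 0 < eulerForm.{w, u} K (idealModule J) S) :
    eulerForm.{w, u} K (idealModule (Module.annihilator A S * J)) T =
      eulerForm.{w, u} K (idealModule J) T -
        eulerForm.{w, u} K (idealModule J) S * eulerForm.{w, u} K S T := by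
  have := hS.simple
  have := hS.finite
  have := hT.finite
  have := hJ.finiteDimensional_hom hA S
  rw [hJ.eulerForm_eq hA hS ((hJ.eulerForm_pos_iff hA hS).1 h)]
  obtain ⟨q, w, hE, -⟩ := exists_idealModule_shortExact S hS.split J
  have := hA.hasProjectiveDimensionLT (powModule S (Module.finrank K (idealModule J ⟶ S)))
  have e := eulerForm_shortExact (K := K) hE ((hJ.mul hA hS).extFinite hA T)
    (hA.extFinite (powModule S _) T)
  rw [eulerForm_powModule (hA.extFinite S T) hA.hasProjectiveDimensionLT] at e
  exact eq_sub_of_add_eq e.symm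

/-- Ext²(A/J, S) is a quotient of Ext¹(J, S) = 0, and duality turns its vanishing into that of
Hom(S, A/J). -/
lemma subsingleton_hom_quotModule (hA : IsCalabiYau K A 2) (hJ : IsRigidIdeal K J)
    (hS : IsSplitRigid K S) (h : 0 < eulerForm.{w, u} K (idealModule J) S) :
    Subsingleton (S ⟶ quotModule J) := by
  have := hJ.finite
  rw [← hA.subsingleton_ext_two_iff]
  obtain ⟨i, q, w, hT⟩ := quotModule_shortExact J
  have := hJ.subsingleton_ext_one hA hS ((hJ.eulerForm_pos_iff hA hS).1 h)
  refine subsingleton_of_forall_eq 0 fun x => ?_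
  obtain ⟨y, rfl⟩ := surjective_extClass_of_projective (K := K) hT 1 2 rfl x
  rw [this.elim y 0, map_zero]

/-- Otherwise the class of `x` would generate a nonzero submodule of A/J killed by I_S, which would
receive a nonzero map from `S`. -/
lemma mem_of_mul_mem (hA : IsCalabiYau K A 2) (hJ : IsRigidIdeal K J)
    (hS : IsSplitRigid K S) (h : 0 < eulerForm.{w, u} K (idealModule J) S) {x : A}
    (hx : ∀ a ∈ Module.annihilator A S, a * x ∈ J) : x ∈ J := by
  have := hS.simple
  have := hS.finite
  by_contra hxJ
  let Q : Submodule A (A ⧸ J) := Submodule.span A {Submodule.Quotient.mk x}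
  have hx₀ : (⟨Submodule.Quotient.mk x, Submodule.mem_span_singleton_self _⟩ : Q) ≠ 0 :=
    fun h0 => hxJ ((Submodule.Quotient.mk_eq_zero J).1 (congrArg Subtype.val h0))
  obtain ⟨φ, hφ⟩ := exists_hom_ne_zero_of_annihilator_le (A := A) K S (fun a ha =>
    Module.mem_annihilator.2 fun ⟨y, hy⟩ => Subtype.ext (by
      obtain ⟨c, rfl⟩ := Submodule.mem_span_singleton.1 hy
      change a • c • Submodule.Quotient.mk x = 0
      rw [smul_smul, ← Submodule.Quotient.mk_smul, Submodule.Quotient.mk_eq_zero]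
      exact hx _ (Ideal.mul_mem_right c _ ha))) hx₀
  have h0 := (hJ.subsingleton_hom_quotModule hA hS h).elim
    (ModuleCat.ofHom (Q.subtype ∘ₗ φ)) 0
  exact hφ (LinearMap.ext fun s => Subtype.ext congr($h0 s))

lemma le_of_mul_le (hA : IsCalabiYau K A 2) (hJ' : IsRigidIdeal K J')
    (hS : IsSplitRigid K S) (h : 0 < eulerForm.{w, u} K (idealModule J') S)
    (hle : Module.annihilator A S * J ≤ J') : J ≤ J' := fun _ hx =>
  hJ'.mem_of_mul_mem hA hS h fun _ ha => hle (Ideal.mul_mem_mul ha hx)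

end IsRigidIdeal

end RigidIdeals

/-! ### The geometric representation -/

section Reflections

variable {B : Type*} (C : B → B → ℤ)

/-- The simple reflections of a generalized Cartan matrix, acting on weights. -/
def weightReflection (hC : ∀ b, C b b = 2) (b : B) : Equiv.Perm (B → ℤ) :=
  Function.Involutive.toPerm (fun f c => f c - f b * C b c) fun f => funext fun c => by
    simp only [hC]
    ring

variable {C} (hC : ∀ b, C b b = 2)

lemma weightReflection_apply (b : B) (f : B → ℤ) (c : B) :
    weightReflection C hC b f c = f c - f b * C b c := rfl

lemma weightReflection_sq (b : B) : weightReflection C hC b * weightReflection C hC b = 1 := by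
  ext f c
  simp only [Equiv.Perm.mul_apply, Equiv.Perm.one_apply, weightReflection_apply, hC]
  ring

lemma weightReflection_comm {b c : B} (h : C b c = 0) (h' : C c b = 0) :
    weightReflection C hC b * weightReflection C hC c =
      weightReflection C hC c * weightReflection C hC b := by
  ext f d
  simp only [Equiv.Perm.mul_apply, weightReflection_apply, h, h']
  ring

lemma weightReflection_braid {b c : B} (h : C b c = -1) (h' : C c b = -1) :
    weightReflection C hC b * weightReflection C hC c * weightReflection C hC b =
      weightReflection C hC c * weightReflection C hC b * weightReflection C hC c := by
  ext f d
  simp only [Equiv.Perm.mul_apply, weightReflection_apply, h, h', hC]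
  ring

end Reflections

/-! ### Commutation and braid relations between annihilators -/

section Relations

variable {K : Type w} [Field K] {A : Type u} [Ring A] [Algebra K A] {S T : ModuleCat.{u} A}

/-- The weight of I_S I_T at `T` is −χ(A, T) < 0, so I_T absorbs: I_S I_T = I_T I_S I_T, which lies
in I_T I_S. -/
lemma annihilator_mul_le_of_eulerForm_eq_zero (hA : IsCalabiYau K A 2) (hS : IsSplitRigid K S)
    (hT : IsSplitRigid K T) (hST : eulerForm.{w, u} K S T = 0)
    (hTS : eulerForm.{w, u} K T S = 0) :
    Module.annihilator A S * Module.annihilator A T ≤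
      Module.annihilator A T * Module.annihilator A S := by
  have h₀ := IsRigidIdeal.top K (A := A)
  have h₁ := h₀.mul hA hT
  have h₂ := h₁.mul hA hS
  have s₀ := IsRigidIdeal.eulerForm_top_pos hA hS
  have t₀ := IsRigidIdeal.eulerForm_top_pos hA hT
  have s₁ := h₀.eulerForm_mul hA hT hS t₀
  have t₁ := h₀.eulerForm_mul hA hT hT t₀
  rw [hTS, mul_zero, sub_zero] at s₁
  rw [hT.eulerForm_self hA] at t₁
  have t₂ := h₁.eulerForm_mul hA hS hT (by rwa [s₁])
  rw [hST, mul_zero, sub_zero, t₁] at t₂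
  have e := h₂.mul_eq_of_nonpos hA hT (by rw [t₂]; linarith)
  rw [Ideal.mul_top] at e
  rw [← e]
  exact Ideal.mul_mono_right Ideal.mul_le_left

/-- Three reflections bring the weight of I_S I_T I_S at `T` to −χ(A, S) < 0, so a further factor
I_T is absorbed, and dropping the last I_S gives the inclusion. -/
lemma annihilator_mul_mul_le_of_eulerForm_eq_neg_one (hA : IsCalabiYau K A 2)
    (hS : IsSplitRigid K S) (hT : IsSplitRigid K T) (hST : eulerForm.{w, u} K S T = -1)
    (hTS : eulerForm.{w, u} K T S = -1) :
    Module.annihilator A S * (Module.annihilator A T * Module.annihilator A S) ≤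
      Module.annihilator A T * (Module.annihilator A S * Module.annihilator A T) := by
  have h₀ := IsRigidIdeal.top K (A := A)
  have h₁ := h₀.mul hA hS
  have h₂ := h₁.mul hA hT
  have h₃ := h₂.mul hA hS
  have s₀ := IsRigidIdeal.eulerForm_top_pos hA hS
  have t₀ := IsRigidIdeal.eulerForm_top_pos hA hT
  have s₁ := h₀.eulerForm_mul hA hS hS s₀
  have t₁ := h₀.eulerForm_mul hA hS hT s₀
  rw [hS.eulerForm_self hA] at s₁
  rw [hST] at t₁
  have s₂ := h₁.eulerForm_mul hA hT hS (by rw [t₁]; linarith)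
  have t₂ := h₁.eulerForm_mul hA hT hT (by rw [t₁]; linarith)
  rw [hT.eulerForm_self hA] at t₂
  rw [hTS] at s₂
  have t₃ := h₂.eulerForm_mul hA hS hT (by rw [s₂, s₁, t₁]; linarith)
  rw [hST] at t₃
  have e := h₃.mul_eq_of_nonpos hA hT (by rw [t₃, t₂, s₂, s₁, t₁]; linarith)
  rw [Ideal.mul_top] at e
  rw [← e]
  exact Ideal.mul_mono_right (Ideal.mul_mono_right Ideal.mul_le_left)

lemma eulerForm_eq_of_iso_left (hA : IsCalabiYau K A 2) {S' : ModuleCat.{u} A} (e : S ≅ S')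
    [FiniteDimensional K S] [FiniteDimensional K T] :
    eulerForm.{w, u} K S T = eulerForm.{w, u} K S' T := by
  -- The isomorphism is read as a short exact sequence with third term the zero module S^0.
  obtain ⟨h, hE⟩ := ModuleCat.shortExact_mk e.hom (0 : S' ⟶ powModule S 0)
    e.toLinearEquiv.injective
    (fun x => ⟨fun _ => e.toLinearEquiv.surjective x, fun _ => rfl⟩)
    (fun x => ⟨0, Subsingleton.elim _ _⟩)
  have := hA.hasProjectiveDimensionLT (powModule S 0)
  have h₁ := eulerForm_shortExact (K := K) hE (hA.extFinite S T) (hA.extFinite (powModule S 0) T)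
  rw [eulerForm_powModule (hA.extFinite S T) hA.hasProjectiveDimensionLT, Nat.cast_zero, zero_mul,
    add_zero] at h₁
  exact h₁.symm

end Relations

/-! ### The descent system of ideals -/

section Main

variable {K : Type w} [Field K] {A : Type u} [Ring A] [Algebra K A] {𝒮 : Set (ModuleCat.{u} A)}

/-- A representative of an isomorphism class. -/
noncomputable def IsoClass.rep (b : IsoClass 𝒮) : 𝒮 := Quotient.out b

@[simp]
lemma IsoClass.mk_rep (b : IsoClass 𝒮) : IsoClass.mk b.rep = b := Quotient.out_eq b

lemma IsoClass.mk_eq_mk_iff {S T : 𝒮} :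
    IsoClass.mk S = IsoClass.mk T ↔ Nonempty (S.1 ≅ T.1) := Quotient.eq

lemma IsoClass.nonempty_iso (S : 𝒮) : Nonempty ((IsoClass.mk S).rep.1 ≅ S.1) :=
  IsoClass.mk_eq_mk_iff.1 (IsoClass.mk_rep _)

lemma IsoClass.isEmpty_iso {b c : IsoClass 𝒮} (h : b ≠ c) : IsEmpty (b.rep.1 ≅ c.rep.1) :=
  ⟨fun e => h (by rw [← b.mk_rep, ← c.mk_rep, IsoClass.mk_eq_mk_iff]; exact ⟨e⟩)⟩

lemma IsoClass.annihilator_rep (S : 𝒮) :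
    Module.annihilator A (IsoClass.mk S).rep.1 = Module.annihilator A S.1 := by
  obtain ⟨e⟩ := IsoClass.nonempty_iso S
  exact e.toLinearEquiv.annihilator_eq

/-- The descent system of rigid ideals of finite codimension. -/
noncomputable def idealDescent (hA : IsCalabiYau K A 2) (h𝒮 : ∀ S : 𝒮, IsSplitRigid K S.1) :
    DescentSystem (IsoClass 𝒮) {J : Ideal A // IsRigidIdeal K J} where
  p b x := ⟨Module.annihilator A b.rep.1 * x.1, x.2.mul hA (h𝒮 _)⟩
  h x b := eulerForm.{w, u} K (idealModule x.1) b.rep.1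
  C b c := eulerForm.{w, u} K b.rep.1 c.rep.1
  x₀ := ⟨⊤, IsRigidIdeal.top K⟩
  C_symm b c :=
    have := (h𝒮 b.rep).finite
    have := (h𝒮 c.rep).finite
    hA.eulerForm_symm _ _
  C_self b := (h𝒮 _).eulerForm_self hA
  C_nonpos b c h := by
    rw [(h𝒮 _).eulerForm_eq_neg hA (h𝒮 _) (IsoClass.isEmpty_iso h)]
    omega
  h_base b := IsRigidIdeal.eulerForm_top_pos hA (h𝒮 _)
  p_of_nonpos x b h := Subtype.ext (x.2.mul_eq_of_nonpos hA (h𝒮 _) h)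
  h_p x b h c := x.2.eulerForm_mul hA (h𝒮 _) (h𝒮 _) h
  p_inj x y b hx hy h := by
    have h := congrArg Subtype.val h
    exact Subtype.ext (le_antisymm
      (y.2.le_of_mul_le hA (h𝒮 _) hy (h.le.trans Ideal.mul_le_right))
      (x.2.le_of_mul_le hA (h𝒮 _) hx (h.ge.trans Ideal.mul_le_right)))
  p_comm b c h x := by
    have := (h𝒮 b.rep).finite
    have := (h𝒮 c.rep).finite
    have h' := hA.eulerForm_symm b.rep.1 c.rep.1 ▸ h
    refine Subtype.ext ?_
    simp only [← Ideal.mul_assoc]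
    exact congrArg (· * x.1) (le_antisymm
      (annihilator_mul_le_of_eulerForm_eq_zero hA (h𝒮 _) (h𝒮 _) h h')
      (annihilator_mul_le_of_eulerForm_eq_zero hA (h𝒮 _) (h𝒮 _) h' h))
  p_braid b c h x := by
    have := (h𝒮 b.rep).finite
    have := (h𝒮 c.rep).finite
    have h' := hA.eulerForm_symm b.rep.1 c.rep.1 ▸ h
    refine Subtype.ext ?_
    have := congrArg (· * x.1) (le_antisymm
      (annihilator_mul_mul_le_of_eulerForm_eq_neg_one hA (h𝒮 _) (h𝒮 _) h h')
      (annihilator_mul_mul_le_of_eulerForm_eq_neg_one hA (h𝒮 _) (h𝒮 _) h' h))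
    simpa only [Ideal.mul_assoc] using this

variable (hA : IsCalabiYau K A 2) (h𝒮 : ∀ S : 𝒮, IsSplitRigid K S.1)

lemma idealDescent_foldr (L : List 𝒮) :
    ((L.map IsoClass.mk).foldr (idealDescent hA h𝒮).p (idealDescent hA h𝒮).x₀).1 = annProd L := by
  induction L with
  | nil => rfl
  | cons S L ih =>
    rw [annProd, ← ih, ← IsoClass.annihilator_rep]
    rfl

lemma idealDescent_C_mk (S T : 𝒮) :
    (idealDescent hA h𝒮).C (.mk S) (.mk T) = eulerForm.{w, u} K S.1 T.1 := by
  obtain ⟨e⟩ := IsoClass.nonempty_iso S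
  obtain ⟨e'⟩ := IsoClass.nonempty_iso T
  have := (h𝒮 S).finite
  have := (h𝒮 T).finite
  have := (h𝒮 (IsoClass.mk S).rep).finite
  have := (h𝒮 (IsoClass.mk T).rep).finite
  refine (eulerForm_eq_of_iso_left hA e).trans ?_
  rw [hA.eulerForm_symm, eulerForm_eq_of_iso_left hA e', hA.eulerForm_symm]

lemma idealDescent_C_mk_of_ne {S T : 𝒮} (h : IsoClass.mk S ≠ IsoClass.mk T) :
    (idealDescent hA h𝒮).C (.mk S) (.mk T) =
      - (Module.finrank K (Abelian.Ext.{u} S.1 T.1 1) : ℤ) := by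
  rw [idealDescent_C_mk]
  exact (h𝒮 S).eulerForm_eq_neg hA (h𝒮 T) (not_nonempty_iff.1 (mt IsoClass.mk_eq_mk_iff.2 h))

/-- The diagonal of the Cartan matrix is 2, so a nonpositive entry separates the classes; finite
dimension then identifies rank with `finrank`. -/
lemma numArrows_eq_of_C_eq {b c : IsoClass 𝒮} {n : ℕ} (h : (idealDescent hA h𝒮).C b c = - (n : ℤ)) :
    numArrows K b.rep.1 c.rep.1 = n := by
  have := (h𝒮 b.rep).finite
  have := (h𝒮 c.rep).finite
  have := hA.extFinite b.rep.1 c.rep.1 1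
  have hbc : b ≠ c := by
    rintro rfl
    rw [DescentSystem.C_self] at h
    omega
  rw [← b.mk_rep, ← c.mk_rep] at hbc h
  rw [idealDescent_C_mk_of_ne hA h𝒮 hbc] at h
  rw [numArrows, ← Module.finrank_eq_rank]
  exact_mod_cast neg_injective h

/-- The generators of the Coxeter group satisfy the relations attached to the Euler form. -/
def idealCoxeterElements : CoxeterElements (idealDescent hA h𝒮).C (CoxGroup K 𝒮) where
  s b := PresentedGroup.of b
  sq b := by
    have := PresentedGroup.one_of_mem (rels := {r | CoxRel K 𝒮 r}) (CoxRel.sq b.rep)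
    rwa [b.mk_rep] at this
  comm b c h := by
    have := PresentedGroup.one_of_mem (rels := {r | CoxRel K 𝒮 r})
      (CoxRel.comm b.rep c.rep (by simpa using numArrows_eq_of_C_eq hA h𝒮 (n := 0) (by simpa using h)))
    rw [b.mk_rep, c.mk_rep] at this
    exact mul_inv_eq_one.1 this
  braid b c h := by
    have := PresentedGroup.one_of_mem (rels := {r | CoxRel K 𝒮 r})
      (CoxRel.braid b.rep c.rep
        (by simpa using numArrows_eq_of_C_eq hA h𝒮 (n := 1) (by simpa using h)))
    rw [b.mk_rep, c.mk_rep] at this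
    exact mul_inv_eq_one.1 this

lemma exists_list_prod_eq (w : CoxGroup K 𝒮) :
    ∃ L : List (IsoClass 𝒮), (L.map (idealCoxeterElements hA h𝒮).s).prod = w := by
  have hw : w ∈ Subgroup.closure (Set.range PresentedGroup.of) := by
    rw [PresentedGroup.closure_range_of]
    trivial
  induction hw using Subgroup.closure_induction with
  | mem x hx =>
    obtain ⟨b, rfl⟩ := hx
    exact ⟨[b], by simp [idealCoxeterElements]⟩
  | one => exact ⟨[], rfl⟩
  | mul x y _ _ hx hy =>
    obtain ⟨L, rfl⟩ := hx
    obtain ⟨L', rfl⟩ := hy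
    exact ⟨L ++ L', by simp⟩
  | inv x _ hx =>
    obtain ⟨L, rfl⟩ := hx
    refine ⟨L.reverse, ?_⟩
    rw [List.prod_inv_reverse, List.map_reverse, List.map_map]
    congr 2
    exact List.map_congr_left fun b _ =>
      (inv_eq_of_mul_eq_one_left ((idealCoxeterElements hA h𝒮).sq b)).symm

lemma exists_geometric_representation :
    ∃ ρ : CoxGroup K 𝒮 →* Equiv.Perm (IsoClass 𝒮 → ℤ), ∀ b f c,
      ρ ((idealCoxeterElements hA h𝒮).s b) f c = f c - f b * (idealDescent hA h𝒮).C b c := by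
  let D := idealDescent hA h𝒮
  have hrel : ∀ r ∈ {r | CoxRel K 𝒮 r},
      FreeGroup.lift (weightReflection D.C D.C_self) r = 1 := by
    rintro r (S | ⟨S, T, h⟩ | ⟨S, T, h⟩)
    · simpa using weightReflection_sq D.C_self _
    -- For isomorphic S and T the relator is already trivial in the free group; the Cartan entry,
    -- being 2, would be of no use.
    · by_cases hST : IsoClass.mk S = IsoClass.mk T
      · simp [hST]
      · have hC : D.C (.mk S) (.mk T) = 0 := by
          rw [idealDescent_C_mk_of_ne hA h𝒮 hST, Module.finrank, show Module.rank K _ = _ from h]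
          simp
        simpa [mul_inv_eq_one, ← mul_inv_rev] using
          weightReflection_comm D.C_self hC ((D.C_symm _ _).trans hC)
    · by_cases hST : IsoClass.mk S = IsoClass.mk T
      · simp [hST]
      · have hC : D.C (.mk S) (.mk T) = -1 := by
          rw [idealDescent_C_mk_of_ne hA h𝒮 hST, Module.finrank, show Module.rank K _ = _ from h]
          simp
        rw [map_mul, map_inv, mul_inv_eq_one]
        simpa using weightReflection_braid D.C_self hC ((D.C_symm _ _).trans hC)
  refine ⟨PresentedGroup.toGroup hrel, fun b f c => ?_⟩
  change (PresentedGroup.toGroup hrel (PresentedGroup.of b)) f c = _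
  rw [PresentedGroup.toGroup.of]
  rfl

end Main

theorem theorem1p8 {K : Type w} [Field K] {A : Type u} [Ring A] [Algebra K A]
    (hA : IsCalabiYau K A 2)
    (𝒮 : Set (ModuleCat.{u} A))
    (h_simple : ∀ S ∈ 𝒮, IsSimpleModule A S)
    (h_findim : ∀ S ∈ 𝒮, FiniteDimensional K S)
    (h_rigid : ∀ S ∈ 𝒮, Subsingleton (Abelian.Ext.{u} S S 1))
    (h_split : ∀ S ∈ 𝒮, Function.Bijective (algebraMap K (Module.End A S))) :
    ∃ f : CoxGroup K 𝒮 → annProdSet 𝒮,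
      (∀ (w : CoxGroup K 𝒮) (L : List 𝒮), IsReducedExpr K L w → (f w : Ideal A) = annProd L) ∧
      Function.Bijective f := by
  have h𝒮 : ∀ S : 𝒮, IsSplitRigid K S.1 := fun S =>
    ⟨h_simple _ S.2, h_findim _ S.2, h_rigid _ S.2, h_split _ S.2⟩
  have hrep : ∀ L : List (IsoClass 𝒮), (L.map IsoClass.rep).map IsoClass.mk = L := fun L => by
    rw [List.map_map]
    exact (List.map_congr_left fun b _ => b.mk_rep).trans (List.map_id L)
  obtain ⟨ρ, hρ⟩ := exists_geometric_representation hA h𝒮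
  obtain ⟨f, hf, hinj, hsurj⟩ := (idealDescent hA h𝒮).exists_bijective
    (idealCoxeterElements hA h𝒮) (exists_list_prod_eq hA h𝒮) ρ hρ
  refine ⟨fun w => ⟨(f w).1.1, ?_⟩, fun w L hL => ?_, fun w w' h => hinj ?_, ?_⟩
  · obtain ⟨L, hL⟩ := (f w).2
    refine ⟨L.map IsoClass.rep, ?_⟩
    rw [← idealDescent_foldr hA h𝒮, hrep, ← hL]
  · have hprod : ∀ L : List 𝒮, ((L.map IsoClass.mk).map (idealCoxeterElements hA h𝒮).s).prod =
        (L.map (coxGen K)).prod := fun L => by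
      rw [List.map_map]
      rfl
    rw [← idealDescent_foldr hA h𝒮, ← hL.1, ← hprod]
    refine congrArg Subtype.val (hf _ fun L' hL' => ?_)
    -- Minimality is stated for words in 𝒮; a competing word in isomorphism classes lifts through
    -- representatives without changing its length.
    rw [← hrep L', hprod, hprod, hL.1] at hL'
    simpa using hL.2 _ hL'
  · have h' : (f w).1.1 = (f w').1.1 := congrArg (fun x : annProdSet 𝒮 => x.1) h
    exact Subtype.ext (Subtype.ext h')
  · rintro ⟨_, L, rfl⟩
    obtain ⟨w, hw⟩ := hsurj ⟨_, L.map IsoClass.mk, rfl⟩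
    exact ⟨w, Subtype.ext ((congrArg (fun x => x.1.1) hw).trans (idealDescent_foldr hA h𝒮 L))⟩
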